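/- Let $M$ be a smooth (Hausdorff) manifold of dimension $n+d$ with $d\geq 1$, let $I\subset M$ be an embedded submanifold of dimension $n$ (around each of its points there is a smooth chart $(x^1,\dots,x^n,h^1,\dots,h^d)$ of $M$ in which $I=\{h=0\}$), and let $p\in I$. For $U\subset M$ open, let $\mathcal{I}(U)\subset C^\infty(U)$ be the ideal of smooth functions on $U$ that vanish on $I\cap U$. A smooth vector field $\rho$ on $U$ is called Euler if $\rho f-f\in\mathcal{I}(U)^2$ for all $f\in\mathcal{I}(U)$. Let $\rho_1,\rho_2$ be Euler vector fields defined on open neighborhoods $U_1,U_2$ of $p$, and let $S_a(\lambda)=e^{\log\lambda\,\rho_a}$, $\lambda\in(0,1]$, $a=1,2$, be the corresponding local scaling flows: $y=S_a(\lambda)(x)$ means that the integral curve of $\rho_a$ with initial point $x$ exists in $U_a$ for all times between $0$ and $\log\lambda$ and is at $y$ at time $\log\lambda$. Then: (1) There is a germ of diffeomorphism at $p$ that conjugates $\rho_2$ to $\rho_1$: there are open neighborhoods $W_2\subset U_2$ and $W_1\subset U_1$ of $p$ and a smooth diffeomorphism $\Psi:W_2\to W_1$ with $\Psi(p)=p$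 and $\rho_1=\Psi_*\rho_2$ on $W_1$. (2) There is a smooth family $(\Phi(\lambda))_{\lambda\in[0,1]}$ of germs of diffeomorphisms at $p$ fixing $p$ with $S_2(\lambda)=S_1(\lambda)\circ\Phi(\lambda)$ for $\lambda\in(0,1]$: there are an open neighborhood $V$ of $p$ and a map $\Phi:[0,1]\times V\to M$, smooth on $[0,1]\times V$, such that for each $\lambda\in[0,1]$ one has $\Phi(\lambda)(p)=p$ and $\Phi(\lambda)$ is a local diffeomorphism at every point of $V$, and such that for all $\lambda\in(0,1]$ and $x\in V$ both $S_2(\lambda)(x)$ and $S_1(\lambda)(\Phi(\lambda)(x))$ are defined and they are equal. -/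

import Mathlib

open Set Filter Topology TopologicalSpace
open scoped Manifold ContDiff

namespace EulerField

variable {n d : ℕ} {M : Type*} [TopologicalSpace M]
  [ChartedSpace (EuclideanSpace ℝ (Fin (n + d))) M]

/-- `I` is an embedded submanifold of dimension `n` (codimension `d`) of the `(n + d)`-dimensional
manifold `M`: around each of its points there is a smooth chart `(x¹, …, xⁿ, h¹, …, hᵈ)` of `M`
in which `I` is the slice `{h = 0}`. -/
def IsEmbeddedSubmanifold (n d : ℕ) {M : Type*} [TopologicalSpace M]
    [ChartedSpace (EuclideanSpace ℝ (Fin (n + d))) M] (I : Set M) : Prop :=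
  ∀ p ∈ I, ∃ φ ∈ IsManifold.maximalAtlas (𝓡 (n + d)) ∞ M, p ∈ φ.source ∧
    ∀ q ∈ φ.source, q ∈ I ↔ ∀ j : Fin d, φ q (Fin.natAdd n j) = 0

/-- The ideal `𝓘(U)` of the ring `C^∞(U)` consisting of the functions that vanish on `I ∩ U`. -/
def vanishingIdeal (I : Set M) (U : Opens M) :
    Ideal C^∞⟮𝓡 (n + d), U; 𝓘(ℝ, ℝ), ℝ⟯ where
  carrier := {f | ∀ x : U, (x : M) ∈ I → f x = 0}
  zero_mem' := fun _ _ => rfl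
  add_mem' := fun {f g} hf hg x hx => by
    have h1 := hf x hx
    have h2 := hg x hx
    simp [h1, h2]
  smul_mem' := fun c f hf x hx => by
    have h1 := hf x hx
    simp [h1]

/-- The derivative `(X f)(x) = df_x (X x)` at `x : U` of a function `f` on the open set `U`
along the vector field `X`. (The values that extend `f` outside `U` do not matter.) -/
noncomputable def lieDeriv {U : Opens M} (X : (x : M) → TangentSpace (𝓡 (n + d)) x)
    (f : U → ℝ) (x : U) : ℝ :=
  mfderiv (𝓡 (n + d)) 𝓘(ℝ, ℝ) (Function.extend ((↑) : U → M) f 0) (x : M) (X x)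

/-- `X` is a smooth vector field on the open set `U`; its values outside `U` are irrelevant. -/
def IsSmoothFieldOn (U : Opens M) (X : (x : M) → TangentSpace (𝓡 (n + d)) x)
    [IsManifold (𝓡 (n + d)) ∞ M] : Prop :=
  ContMDiffOn (𝓡 (n + d)) (𝓡 (n + d)).tangent ∞
    (fun x => (⟨x, X x⟩ : TangentBundle (𝓡 (n + d)) M)) U

/-- `ρ` is an Euler vector field on `U` (with respect to `I`): it is smooth on `U`, and
`ρ f - f ∈ 𝓘(U)²` for all `f ∈ 𝓘(U)`. -/
def IsEulerOn [IsManifold (𝓡 (n + d)) ∞ M] (I : Set M) (U : Opens M)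
    (ρ : (x : M) → TangentSpace (𝓡 (n + d)) x) : Prop :=
  IsSmoothFieldOn U ρ ∧
    ∀ f ∈ vanishingIdeal (n := n) (d := d) I U, ∃ g ∈ vanishingIdeal (n := n) (d := d) I U ^ 2,
      ∀ x : U, lieDeriv ρ f x - f x = g x

/-- The push-forward `(Ψ_* X)(y) = dΨ_{Ψ⁻¹ y} (X (Ψ⁻¹ y))`, meaningful for `y ∈ Ψ.target`. -/
noncomputable def pushforward (Ψ : OpenPartialHomeomorph M M)
    (X : (x : M) → TangentSpace (𝓡 (n + d)) x) (y : M) : TangentSpace (𝓡 (n + d)) y :=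
  mfderiv (𝓡 (n + d)) (𝓡 (n + d)) Ψ (Ψ.symm y) (X (Ψ.symm y))

/-- `y = e^{log lam • X} x`, for the flow of `X` inside `U`: the integral curve of `X` that
starts at `x` exists in `U` for all times between `0` and `log lam`, and it is at `y` at time
`log lam`. -/
def ScalesTo (X : (x : M) → TangentSpace (𝓡 (n + d)) x) (U : Opens M) (lam : ℝ) (x y : M) :
    Prop :=
  ∃ γ : ℝ → M, IsMIntegralCurveOn (I := 𝓡 (n + d)) γ X (uIcc 0 (Real.log lam)) ∧
    (∀ t ∈ uIcc 0 (Real.log lam), γ t ∈ U) ∧ γ 0 = x ∧ γ (Real.log lam) = y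

/-- `(Φ lam)`, `lam ∈ [0, 1]`, is a smooth family of germs of diffeomorphisms at `p` fixing `p`,
all of them defined on the neighbourhood `V` of `p`: the map `(lam, x) ↦ Φ lam x` is smooth on
`[0, 1] × V`, and each `Φ lam` fixes `p` and is a local diffeomorphism at every point of `V`. -/
def IsSmoothFamilyOfDiffeoGerms (n d : ℕ) {M : Type*} [TopologicalSpace M]
    [ChartedSpace (EuclideanSpace ℝ (Fin (n + d))) M] (p : M) (V : Opens M)
    (Φ : ℝ → M → M) : Prop :=
  p ∈ V ∧
  ContMDiffOn (𝓘(ℝ, ℝ).prod (𝓡 (n + d))) (𝓡 (n + d)) ∞ (fun q : ℝ × M => Φ q.1 q.2)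
    (Icc (0 : ℝ) 1 ×ˢ (V : Set M)) ∧
  ∀ lam ∈ Icc (0 : ℝ) 1, Φ lam p = p ∧
    IsLocalDiffeomorphOn (𝓡 (n + d)) (𝓡 (n + d)) ∞ (Φ lam) V

end EulerField

/-! In a slice chart let P be the projection onto the normal coordinates h, and let D_a = `dilation
P a` be (x, h) ↦ (x, a h). Testing the Euler condition on the h_j and on products of a coordinate
with some h_j shows that an Euler field reads X = P + R, where R vanishes on {h = 0} and P R
vanishes there to second order (`IsEulerOn.exists_chartField`).

The core is `exists_linearizing_map`: X is the image of the linear field P, whose flow at time log λ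
is D_λ. By Hadamard's lemma R(D_a w) = a D_a G(a, w) with G smooth up to a = 0
(`ContDiff.exists_dilation_blowup`). If u' = G(s, u) and u(0) = z, then y(s) = D_s u(s) satisfies s
y' = P y + R(y), so y is a trajectory of X in the time log s; the singular problem at s = 0 has
become a regular one. Put Θ(z) = u(1). Uniqueness gives Θ(D_m z) = D_m u(m), and differentiating at
m = 1 yields dΘ(P z) = X(Θ z). Existence, uniqueness and smooth dependence of u come together from
the inverse function theorem on E × C([0,1], E) (`exists_volterra_solution`).

Let Θ₁, Θ₂ linearize the two fields. Then Ψ = Θ₁ Θ₂⁻¹ proves (1). For (2), T = Θ₁⁻¹ Θ₂ fixes the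
slice pointwise, so K_a = D_a⁻¹ T D_a extends smoothly to a = 0
(`exists_local_dilation_conj_equiv`). Take Φ(λ) = Θ₁ K_λ Θ₂⁻¹: indeed Θ₂ D_λ Θ₂⁻¹ = Θ₁ T D_λ Θ₂⁻¹ =
Θ₁ D_λ K_λ Θ₂⁻¹. -/

/-! ### Smoothness of superposition operators on spaces of continuous functions. -/

section Nemytskii

universe u

variable {K : Type*} [TopologicalSpace K] [CompactSpace K]
  {E F : Type u} [NormedAddCommGroup E] [NormedSpace ℝ E] [NormedAddCommGroup F] [NormedSpace ℝ F]

/-- Pointwise evaluation of a continuous family of operators on a continuous function. -/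
noncomputable def ContinuousMap.clmApply : C(K, E →L[ℝ] F) →L[ℝ] C(K, E) →L[ℝ] C(K, F) :=
  LinearMap.mkContinuous₂
    (LinearMap.mk₂ ℝ (fun (A : C(K, E →L[ℝ] F)) (v : C(K, E)) =>
        (⟨fun k => A k (v k), by fun_prop⟩ : C(K, F)))
      (fun _ _ _ => by ext; simp) (fun _ _ _ => by ext; simp)
      (fun _ _ _ => by ext; simp) (fun _ _ _ => by ext; simp)) 1
    (fun A v => by
      rw [ContinuousMap.norm_le _ (by positivity), one_mul]
      intro k
      exact (A k).le_of_opNorm_le_of_le (A.norm_coe_le_norm k) (v.norm_coe_le_norm k))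

@[simp] lemma ContinuousMap.clmApply_apply (A : C(K, E →L[ℝ] F)) (v : C(K, E)) (k : K) :
    ContinuousMap.clmApply A v k = A k (v k) := rfl

/-- The superposition operator `u ↦ f ∘ u` of a continuous map `f`. -/
def ContinuousMap.superpose {f : E → F} (hf : Continuous f) (u : C(K, E)) : C(K, F) :=
  (⟨f, hf⟩ : C(E, F)).comp u

omit [CompactSpace K] [NormedSpace ℝ E] [NormedSpace ℝ F] in
@[simp] lemma ContinuousMap.superpose_apply {f : E → F} (hf : Continuous f) (u : C(K, E)) (k : K) :
    ContinuousMap.superpose hf u k = f (u k) := rfl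

omit [CompactSpace K] [NormedSpace ℝ E] [NormedSpace ℝ F] in
lemma ContinuousMap.continuous_superpose {f : E → F} (hf : Continuous f) :
    Continuous (ContinuousMap.superpose (K := K) hf) :=
  ContinuousMap.continuous_postcomp _

/-- The mean value inequality on each segment from `u k` to `u k + h k`; the estimate is uniform in
`k` because superposition with `fderiv ℝ f` is continuous in the sup norm. -/
lemma ContinuousMap.hasFDerivAt_superpose {f : E → F} (hf : ContDiff ℝ 1 f) (u : C(K, E)) :
    HasFDerivAt (ContinuousMap.superpose (K := K) hf.continuous)
      (ContinuousMap.clmApply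
        (ContinuousMap.superpose (hf.continuous_fderiv one_ne_zero) u)) u := by
  have hdf := hf.continuous_fderiv one_ne_zero
  rw [hasFDerivAt_iff_isLittleO_nhds_zero, Asymptotics.isLittleO_iff]
  intro ε hε
  have hc := (ContinuousMap.continuous_superpose (K := K) hdf).continuousAt (x := u)
  obtain ⟨δ, hδ, hc⟩ := Metric.continuousAt_iff.1 hc ε hε
  filter_upwards [Metric.ball_mem_nhds (0 : C(K, E)) hδ] with h hh
  rw [mem_ball_zero_iff] at hh
  rw [ContinuousMap.norm_le _ (by positivity)]
  intro k
  have hseg : ∀ y ∈ segment ℝ (u k) (u k + h k), ‖fderiv ℝ f y - fderiv ℝ f (u k)‖ ≤ ε := by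
    intro y hy
    rw [segment_eq_image'] at hy
    obtain ⟨s, hs, rfl⟩ := hy
    have h1 : dist (u + s • h) u < δ := by
      rw [dist_eq_norm, add_sub_cancel_left, norm_smul, Real.norm_of_nonneg hs.1]
      exact lt_of_le_of_lt (mul_le_of_le_one_left (norm_nonneg _) hs.2) hh
    have h2 := (hc h1).le
    rw [dist_eq_norm, ContinuousMap.norm_le _ hε.le] at h2
    simpa using h2 k
  have hmv := (convex_segment (u k) (u k + h k)).norm_image_sub_le_of_norm_hasFDerivWithin_le'
    (𝕜 := ℝ) (f := f) (f' := fun y => fderiv ℝ f y) (φ := fderiv ℝ f (u k))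
    (fun y _ => ((hf.differentiable one_ne_zero) y).hasFDerivAt.hasFDerivWithinAt) hseg
    (left_mem_segment _ _ _) (right_mem_segment _ _ _)
  simp only [add_sub_cancel_left] at hmv
  calc _ = ‖f (u k + h k) - f (u k) - fderiv ℝ f (u k) (h k)‖ := by simp
    _ ≤ ε * ‖h k‖ := hmv
    _ ≤ ε * ‖h‖ := by gcongr; exact h.norm_coe_le_norm k

/-- The derivative is again a superposition operator, that of `fderiv ℝ f`, followed by a continuous
linear map. Its target is `E →L[ℝ] F`, so the induction ranges over all `F`, in the universe of `E`.
-/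
lemma ContinuousMap.contDiff_superpose_nat (n : ℕ) :
    ∀ {F : Type u} [NormedAddCommGroup F] [NormedSpace ℝ F] {f : E → F} (hf : ContDiff ℝ ∞ f),
      ContDiff ℝ n (ContinuousMap.superpose (K := K) hf.continuous) := by
  induction n with
  | zero =>
    intro F _ _ f hf
    exact contDiff_zero.2 (ContinuousMap.continuous_superpose _)
  | succ n ih =>
    intro F _ _ f hf
    have hf1 : ContDiff ℝ 1 f := hf.of_le (by exact_mod_cast le_top)
    rw [Nat.cast_add, Nat.cast_one, contDiff_succ_iff_hasFDerivAt]
    refine ⟨fun u => ContinuousMap.clmApply (ContinuousMap.superpose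
      (contDiff_infty_iff_fderiv.1 hf).2.continuous u), ?_,
      fun u => ContinuousMap.hasFDerivAt_superpose hf1 u⟩
    exact (ContinuousMap.clmApply (K := K) (E := E) (F := F)).contDiff.comp
      (ih (contDiff_infty_iff_fderiv.1 hf).2)

theorem ContinuousMap.contDiff_superpose {f : E → F} (hf : ContDiff ℝ ∞ f) :
    ContDiff ℝ ∞ (ContinuousMap.superpose (K := K) hf.continuous) :=
  contDiff_infty.2 fun n => ContinuousMap.contDiff_superpose_nat n hf

end Nemytskii

/-! ### Integration as a continuous linear operator on C([0,1], E). -/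

section Primitive

variable {E : Type*} [NormedAddCommGroup E] [NormedSpace ℝ E]

omit [NormedSpace ℝ E] in
lemma ContinuousMap.intervalIntegrable_IccExtend (u : C(unitInterval, E)) (a b : ℝ) :
    IntervalIntegrable (IccExtend (zero_le_one (α := ℝ)) u) MeasureTheory.volume a b :=
  u.continuous.Icc_extend'.intervalIntegrable _ _

/-- The primitive `t ↦ ∫₀ᵗ u` of a continuous function on the unit interval. -/
noncomputable def ContinuousMap.primitiveFun (u : C(unitInterval, E)) : C(unitInterval, E) where
  toFun t := ∫ s in (0 : ℝ)..t, IccExtend (zero_le_one (α := ℝ)) u s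
  continuous_toFun := by
    exact (intervalIntegral.continuous_primitive
      (fun a b => u.intervalIntegrable_IccExtend a b) 0).comp continuous_subtype_val

/-- The primitive `t ↦ ∫₀ᵗ u` as a continuous linear map. -/
noncomputable def ContinuousMap.primitive : C(unitInterval, E) →L[ℝ] C(unitInterval, E) :=
  LinearMap.mkContinuous
    { toFun := ContinuousMap.primitiveFun
      map_add' := fun u v => by
        ext t
        exact intervalIntegral.integral_add (u.intervalIntegrable_IccExtend _ _)
          (v.intervalIntegrable_IccExtend _ _)
      map_smul' := fun c u => by
        ext t
        exact intervalIntegral.integral_smul c _ } 1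
    (fun u => by
      rw [ContinuousMap.norm_le _ (by positivity)]
      intro t
      have := intervalIntegral.norm_integral_le_of_norm_le_const (a := 0) (b := (t : ℝ))
        (f := IccExtend (zero_le_one (α := ℝ)) u) (C := ‖u‖) (fun s _ => u.norm_coe_le_norm _)
      calc _ ≤ _ := this
        _ ≤ ‖u‖ * 1 := by
          gcongr
          rw [sub_zero, abs_of_nonneg t.2.1]
          exact t.2.2
        _ = _ := by ring)

lemma ContinuousMap.primitive_apply (u : C(unitInterval, E)) (t : unitInterval) :
    ContinuousMap.primitive u t = ∫ s in (0 : ℝ)..t, IccExtend (zero_le_one (α := ℝ)) u s := rfl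

lemma ContinuousMap.primitive_apply_of_eqOn {u : C(unitInterval, E)} {f : ℝ → E}
    (h : ∀ s : unitInterval, u s = f s) (t : unitInterval) :
    ContinuousMap.primitive u t = ∫ s in (0 : ℝ)..t, f s := by
  rw [ContinuousMap.primitive_apply]
  refine intervalIntegral.integral_congr fun s hs => ?_
  rw [uIcc_of_le t.2.1] at hs
  have hs' : s ∈ Icc (0 : ℝ) 1 := ⟨hs.1, hs.2.trans t.2.2⟩
  exact (IccExtend_of_mem _ _ hs').trans (h ⟨s, hs'⟩)

end Primitive

/-! ### Division of smooth functions by a parameter. -/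

section Hadamard

universe u

variable {E F : Type u} [NormedAddCommGroup E] [NormedSpace ℝ E]
  [NormedAddCommGroup F] [NormedSpace ℝ F]

/-- The map `(a, w) ↦ (s ↦ (s a, w))`. -/
noncomputable def ContinuousMap.scaleFirst : ℝ × E →L[ℝ] C(unitInterval, ℝ × E) :=
  LinearMap.mkContinuous
    { toFun := fun p => ⟨fun s => ((s : ℝ) * p.1, p.2), by fun_prop⟩
      map_add' := fun p q => by ext s <;> simp [mul_add]
      map_smul' := fun c p => by ext s <;> simp; ring } 1
    (fun p => by
      rw [ContinuousMap.norm_le _ (by positivity), one_mul]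
      intro s
      simp only [LinearMap.coe_mk, AddHom.coe_mk, ContinuousMap.coe_mk, Prod.norm_def]
      refine max_le_max ?_ le_rfl
      rw [norm_mul, Real.norm_of_nonneg s.2.1]
      exact mul_le_of_le_one_left (norm_nonneg _) s.2.2)

@[simp] lemma ContinuousMap.scaleFirst_apply (p : ℝ × E) (s : unitInterval) :
    ContinuousMap.scaleFirst p s = ((s : ℝ) * p.1, p.2) := rfl

/-- **Hadamard's lemma**: a smooth function that vanishes at parameter `0` is divisible by the
parameter. -/
theorem ContDiff.exists_eq_smul_of_zero [CompleteSpace F] {q : ℝ × E → F} (hq : ContDiff ℝ ∞ q)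
    (h0 : ∀ w, q (0, w) = 0) :
    ∃ r : ℝ × E → F, ContDiff ℝ ∞ r ∧ ∀ a w, q (a, w) = a • r (a, w) := by
  have hdq : ContDiff ℝ ∞ (fun p => fderiv ℝ q p ((1 : ℝ), (0 : E))) :=
    (contDiff_infty_iff_fderiv.1 hq).2.clm_apply contDiff_const
  -- The quotient is r(a, w) = ∫₀¹ ∂₁q(s a, w) ds. Written as linear maps around a superposition
  -- operator, it is smooth without any differentiation under the integral.
  refine ⟨fun p => ContinuousMap.primitive
    (ContinuousMap.superpose hdq.continuous (ContinuousMap.scaleFirst p)) 1, ?_, fun a w => ?_⟩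
  · exact (ContinuousMap.evalCLM ℝ (1 : unitInterval)).contDiff.comp
      (ContinuousMap.primitive.contDiff.comp
        ((ContinuousMap.contDiff_superpose hdq).comp ContinuousMap.scaleFirst.contDiff))
  · have hder : ∀ s : ℝ, HasDerivAt (fun s => q (s * a, w))
        (a • fderiv ℝ q (s * a, w) ((1 : ℝ), (0 : E))) s := by
      intro s
      have h1 := (hq.differentiable (by simp) (s * a, w)).hasFDerivAt
      have h2 : HasDerivAt (fun s : ℝ => (s * a, w)) ((1 : ℝ) * a, (0 : E)) s :=
        ((hasDerivAt_id s).mul_const a).prodMk (hasDerivAt_const s w)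
      have h3 := h1.comp_hasDerivAt s h2
      have h4 : (((1 : ℝ) * a, (0 : E)) : ℝ × E) = a • ((1 : ℝ), (0 : E)) := by simp
      rwa [h4, map_smul] at h3
    simp only
    rw [ContinuousMap.primitive_apply_of_eqOn (f := fun s => fderiv ℝ q (s * a, w) (1, 0))
      (fun s => rfl), ← intervalIntegral.integral_smul]
    rw [intervalIntegral.integral_eq_sub_of_hasDerivAt (fun s _ => hder s)]
    · simp [h0]
    · apply Continuous.intervalIntegrable
      exact (hdq.continuous.comp (by fun_prop : Continuous fun s : ℝ => (s * a, w))).const_smul a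

end Hadamard

/-! ### The smooth inverse function theorem in Banach spaces. -/

section InverseFunction

variable {E F : Type*} [NormedAddCommGroup E] [NormedSpace ℝ E] [CompleteSpace E]
  [NormedAddCommGroup F] [NormedSpace ℝ F]

/-- The smooth inverse function theorem, with both directions smooth on their whole domains. -/
theorem ContDiffOn.exists_openPartialHomeomorph {f : E → F} {Ω : Set E} (hΩ : IsOpen Ω)
    (hf : ContDiffOn ℝ ∞ f Ω) {a : E} (ha : a ∈ Ω) {f' : E ≃L[ℝ] F}
    (hf' : HasFDerivAt f (f' : E →L[ℝ] F) a) :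
    ∃ e : OpenPartialHomeomorph E F, a ∈ e.source ∧ e.source ⊆ Ω ∧ (∀ x, e x = f x) ∧
      ContDiffOn ℝ ∞ e e.source ∧ ContDiffOn ℝ ∞ e.symm e.target := by
  have hat : ∀ x ∈ Ω, ContDiffAt ℝ ∞ f x := fun x hx => hf.contDiffAt (hΩ.mem_nhds hx)
  set e₀ := (hat a ha).toOpenPartialHomeomorph f hf' (by simp)
  -- Invertibility of the derivative is an open condition; shrinking the source to it makes the
  -- inverse smooth on the whole target.
  have hS : IsOpen (Ω ∩ fderiv ℝ f ⁻¹' range ((↑) : (E ≃L[ℝ] F) → E →L[ℝ] F)) :=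
    (hf.continuousOn_fderiv_of_isOpen hΩ (by simp)).isOpen_inter_preimage hΩ
      ContinuousLinearEquiv.isOpen
  set e := e₀.restrOpen _ hS
  have hsrc : e.source = e₀.source ∩ (Ω ∩ fderiv ℝ f ⁻¹' range ((↑) : (E ≃L[ℝ] F) → E →L[ℝ] F)) :=
    rfl
  have hsub : e.source ⊆ Ω := hsrc ▸ fun x hx => hx.2.1
  refine ⟨e, ?_, hsub, fun x => rfl, hf.mono hsub, fun y hy => ?_⟩
  · rw [hsrc]
    exact ⟨(hat a ha).mem_toOpenPartialHomeomorph_source hf' (by simp), ha, f', hf'.fderiv.symm⟩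
  · have hx := e.map_target hy
    have hx2 : e.symm y ∈ fderiv ℝ f ⁻¹' range ((↑) : (E ≃L[ℝ] F) → E →L[ℝ] F) := (hsrc ▸ hx).2.2
    obtain ⟨A, hA⟩ := hx2
    have hxf := hat _ (hsub hx)
    refine (e.contDiffAt_symm hy (f₀' := A) ?_ hxf).contDiffWithinAt
    rw [hA]
    exact (hxf.differentiableAt (by simp)).hasFDerivAt

end InverseFunction

/-- Two continuous functions of a real variable that agree away from `0` are equal. -/
lemma Continuous.eq_of_forall_ne_zero {F : Type*} [TopologicalSpace F] [T2Space F] {f g : ℝ → F}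
    (hf : Continuous f) (hg : Continuous g) (h : ∀ s, s ≠ 0 → f s = g s) (s : ℝ) : f s = g s :=
  congrFun (Continuous.ext_on (dense_compl_singleton (0 : ℝ)) hf hg h) s

/-! ### Dilations of the range of a projection. -/

section Dilation

variable {E : Type*} [NormedAddCommGroup E] [NormedSpace ℝ E]

/-- The map that multiplies the range of the projection `P` by `a` and fixes its kernel. -/
noncomputable def dilation (P : E →L[ℝ] E) (a : ℝ) : E →L[ℝ] E :=
  ContinuousLinearMap.id ℝ E - P + a • P

variable {P : E →L[ℝ] E}

lemma dilation_apply (a : ℝ) (x : E) : dilation P a x = x - P x + a • P x := by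
  simp [dilation]

@[simp] lemma dilation_one (x : E) : dilation P 1 x = x := by simp [dilation_apply]

lemma dilation_of_apply_eq_zero (a : ℝ) {x : E} (hx : P x = 0) : dilation P a x = x := by
  simp [dilation_apply, hx]

lemma apply_dilation (hP : ∀ x, P (P x) = P x) (a : ℝ) (x : E) :
    P (dilation P a x) = a • P x := by
  simp [dilation_apply, hP]

lemma dilation_dilation (hP : ∀ x, P (P x) = P x) (a b : ℝ) (x : E) :
    dilation P a (dilation P b x) = dilation P (a * b) x := by
  rw [dilation_apply, apply_dilation hP, dilation_apply, dilation_apply, mul_smul]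
  abel

lemma dilation_injective (hP : ∀ x, P (P x) = P x) {a : ℝ} (ha : a ≠ 0) :
    Function.Injective (dilation P a) := fun x y h => by
  have := congrArg (dilation P a⁻¹) h
  simpa [dilation_dilation hP, inv_mul_cancel₀ ha] using this

lemma contDiff_dilation : ContDiff ℝ ∞ (fun p : ℝ × E => dilation P p.1 p.2) := by
  simp only [dilation_apply]
  fun_prop

lemma continuous_dilation : Continuous (fun p : ℝ × E => dilation P p.1 p.2) :=
  contDiff_dilation.continuous

lemma hasDerivAt_dilation (a : ℝ) (x : E) :
    HasDerivAt (fun a => dilation P a x) (P x) a := by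
  simp only [dilation_apply]
  simpa using ((hasDerivAt_id a).smul_const (P x)).const_add (x - P x)

lemma norm_dilation_le {a : ℝ} (ha : a ∈ Icc (0 : ℝ) 1) (x : E) :
    ‖dilation P a x‖ ≤ (1 + ‖P‖) * ‖x‖ := by
  have h1 : dilation P a x = x - (1 - a) • P x := by
    rw [dilation_apply, sub_smul, one_smul]; abel
  rw [h1]
  calc _ ≤ ‖x‖ + ‖(1 - a) • P x‖ := norm_sub_le _ _
    _ = ‖x‖ + (1 - a) * ‖P x‖ := by
        rw [norm_smul, Real.norm_of_nonneg (sub_nonneg.2 ha.2)]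
    _ ≤ ‖x‖ + 1 * (‖P‖ * ‖x‖) := by
        gcongr
        · linarith [ha.1]
        · exact P.le_opNorm x
    _ = _ := by ring

end Dilation

/-! ### Division of maps and vector fields by the dilations. -/

section BlowUp

universe u

variable {E : Type u} [NormedAddCommGroup E] [NormedSpace ℝ E] [CompleteSpace E] {P : E →L[ℝ] E}

/-- A map that preserves the kernel of `P` has smooth conjugates under the dilations, up to
dilation parameter `0`. -/
theorem ContDiff.exists_dilation_conj (hP : ∀ x, P (P x) = P x) {T : E → E}
    (hT : ContDiff ℝ ∞ T) (h0 : ∀ z, P z = 0 → P (T z) = 0) :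
    ∃ K : ℝ × E → E, ContDiff ℝ ∞ K ∧ ∀ a z, dilation P a (K (a, z)) = T (dilation P a z) := by
  have hTd : ContDiff ℝ ∞ (fun p : ℝ × E => T (dilation P p.1 p.2)) := hT.comp contDiff_dilation
  obtain ⟨r, hr, hr'⟩ := ContDiff.exists_eq_smul_of_zero
    (q := fun p : ℝ × E => P (T (dilation P p.1 p.2))) (P.contDiff.comp hTd)
    (fun w => h0 _ (by rw [apply_dilation hP, zero_smul]))
  -- The tangential part of T D_a is kept and its normal part is replaced by its quotient by `a`.
  refine ⟨fun p => T (dilation P p.1 p.2) - P (T (dilation P p.1 p.2)) + P (r p),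
    (hTd.sub (P.contDiff.comp hTd)).add (P.contDiff.comp hr), fun a z => ?_⟩
  have h1 : a • P (r (a, z)) = P (T (dilation P a z)) := by
    rw [← map_smul, ← hr', hP]
  refine (dilation_apply a _).trans ?_
  simp only [map_add, map_sub, hP, sub_self, zero_add, h1]
  abel

/-- The blow-up of a vector field `R` that vanishes on the kernel of `P`, with `P R` vanishing to
second order. -/
theorem ContDiff.exists_dilation_blowup (hP : ∀ x, P (P x) = P x) {R : E → E}
    (hR : ContDiff ℝ ∞ R) (h0 : ∀ z, P z = 0 → R z = 0)
    (h1 : ∀ z, P z = 0 → HasFDerivAt (fun y => P (R y)) (0 : E →L[ℝ] E) z) :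
    ∃ G : ℝ × E → E, ContDiff ℝ ∞ G ∧ ∀ a w, R (dilation P a w) = a • dilation P a (G (a, w)) := by
  have hRd : ContDiff ℝ ∞ (fun p : ℝ × E => R (dilation P p.1 p.2)) := hR.comp contDiff_dilation
  obtain ⟨r, hr, hr'⟩ := hRd.exists_eq_smul_of_zero
    (fun w => h0 _ (by rw [apply_dilation hP, zero_smul]))
  -- P R(D_a w) = a P r(a, w) has derivative P r(0, w) at a = 0, and this derivative is zero by
  -- `h1`. So the normal part can be divided by `a` a second time.
  have hr0 : ∀ w, P (r (0, w)) = 0 := by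
    intro w
    have hd1 : HasDerivAt (fun a : ℝ => a • P (r (a, w))) (P (r (0, w))) 0 := by
      have hc : DifferentiableAt ℝ (fun a : ℝ => P (r (a, w))) 0 := by
        have : ContDiff ℝ ∞ (fun a : ℝ => P (r (a, w))) :=
          P.contDiff.comp (hr.comp (contDiff_id.prodMk contDiff_const))
        exact (this.differentiable (by simp)) 0
      exact ((hasDerivAt_id (0 : ℝ)).smul hc.hasDerivAt).congr_deriv (by simp)
    have hd2 : HasDerivAt (fun a : ℝ => P (R (dilation P a w))) 0 0 := by
      exact (h1 (dilation P 0 w) (by rw [apply_dilation hP, zero_smul])).comp_hasDerivAt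
        (0 : ℝ) (hasDerivAt_dilation 0 w)
    have he : (fun a : ℝ => P (R (dilation P a w))) = fun a : ℝ => a • P (r (a, w)) := by
      ext a; rw [hr', map_smul]
    rw [he] at hd2
    exact hd1.unique hd2
  obtain ⟨r₂, hr₂, hr₂'⟩ := (P.contDiff.comp hr).exists_eq_smul_of_zero hr0
  refine ⟨fun p => r p - P (r p) + P (r₂ p),
    (hr.sub (P.contDiff.comp hr)).add (P.contDiff.comp hr₂), fun a w => ?_⟩
  have h2 : a • P (r₂ (a, w)) = P (r (a, w)) := by
    rw [← map_smul, ← hr₂']; simp [hP]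
  rw [hr', dilation_apply]
  simp only [map_add, map_sub, hP, sub_self, zero_add, h2]
  congr 1
  abel

end BlowUp

/-! ### An integral equation solved by the inverse function theorem. -/

section Volterra

universe u

variable {E : Type u} [NormedAddCommGroup E] [NormedSpace ℝ E]

/-- The inclusion of the constants into `C([0, 1], E)`. -/
noncomputable def ContinuousMap.constCLM : E →L[ℝ] C(unitInterval, E) :=
  LinearMap.mkContinuous
    { toFun := fun x => ContinuousMap.const _ x
      map_add' := fun _ _ => rfl
      map_smul' := fun _ _ => rfl } 1
    (fun x => by
      rw [ContinuousMap.norm_le _ (by positivity), one_mul]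
      exact fun _ => le_rfl)

@[simp] lemma ContinuousMap.constCLM_apply (x : E) (s : unitInterval) :
    ContinuousMap.constCLM x s = x := rfl

/-- The graph `s ↦ (s, u s)`. -/
def ContinuousMap.graphMap (u : C(unitInterval, E)) : C(unitInterval, ℝ × E) :=
  ⟨fun s => ((s : ℝ), u s), by fun_prop⟩

lemma ContinuousMap.graphMap_eq (u : C(unitInterval, E)) :
    ContinuousMap.graphMap u = ContinuousMap.graphMap 0 +
      (ContinuousLinearMap.inr ℝ ℝ E).compLeftContinuous ℝ unitInterval u := by
  ext s <;> simp [ContinuousMap.graphMap]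

lemma ContinuousMap.contDiff_graphMap :
    ContDiff ℝ ∞ (ContinuousMap.graphMap (E := E)) := by
  rw [funext ContinuousMap.graphMap_eq]
  exact contDiff_const.add
    ((ContinuousLinearMap.inr ℝ ℝ E).compLeftContinuous ℝ unitInterval).contDiff

lemma ContinuousMap.hasFDerivAt_graphMap (u : C(unitInterval, E)) :
    HasFDerivAt (ContinuousMap.graphMap (E := E))
      ((ContinuousLinearMap.inr ℝ ℝ E).compLeftContinuous ℝ unitInterval) u := by
  rw [funext ContinuousMap.graphMap_eq]
  exact ((ContinuousLinearMap.inr ℝ ℝ E).compLeftContinuous ℝ unitInterval).hasFDerivAt.const_add _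

/-- The nonlinear Volterra operator `u ↦ (t ↦ ∫₀ᵗ G (s, u s) ds)`. -/
noncomputable def volterra {G : ℝ × E → E} (hG : Continuous G) (u : C(unitInterval, E)) :
    C(unitInterval, E) :=
  ContinuousMap.primitive (ContinuousMap.superpose hG (ContinuousMap.graphMap u))

variable {G : ℝ × E → E}

lemma volterra_apply (hG : Continuous G) (u : C(unitInterval, E)) (t : unitInterval) :
    volterra hG u t = ∫ s in (0 : ℝ)..t, G (s, IccExtend (zero_le_one (α := ℝ)) u s) :=
  ContinuousMap.primitive_apply_of_eqOn (fun s => by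
    simp [ContinuousMap.graphMap, IccExtend_val]) t

lemma contDiff_volterra (hG : ContDiff ℝ ∞ G) : ContDiff ℝ ∞ (volterra hG.continuous) :=
  (ContinuousMap.primitive (E := E)).contDiff.comp
    ((ContinuousMap.contDiff_superpose hG).comp ContinuousMap.contDiff_graphMap)

lemma hasFDerivAt_volterra (hG : ContDiff ℝ ∞ G) {z₀ : E} {B : E →L[ℝ] E}
    (hB : ∀ s v, fderiv ℝ G (s, z₀) (0, v) = B v) :
    HasFDerivAt (volterra hG.continuous)
      (ContinuousMap.primitive ∘L B.compLeftContinuous ℝ unitInterval)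
      (ContinuousMap.constCLM z₀) := by
  have h1 := (ContinuousMap.hasFDerivAt_superpose (K := unitInterval)
    (hG.of_le (by exact_mod_cast le_top : (1 : WithTop ℕ∞) ≤ ∞))
    (ContinuousMap.graphMap (ContinuousMap.constCLM z₀))).comp _
    (ContinuousMap.hasFDerivAt_graphMap (ContinuousMap.constCLM z₀))
  refine (ContinuousMap.primitive.hasFDerivAt.comp _ h1).congr_fderiv ?_
  refine ContinuousLinearMap.ext fun v => congrArg ContinuousMap.primitive ?_
  ext s
  exact hB s (v s)

/-- A time-independent `B` commutes with integration, so `B * B = 0` passes to the Volterra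
operator. Hence `id - V` has the inverse `id + V`, and no smallness of `B` is required. -/
lemma primitive_compLeftContinuous_sq [CompleteSpace E] {B : E →L[ℝ] E} (hB : ∀ v, B (B v) = 0)
    (u : C(unitInterval, E)) :
    ContinuousMap.primitive (B.compLeftContinuous ℝ unitInterval
      (ContinuousMap.primitive (B.compLeftContinuous ℝ unitInterval u))) = 0 := by
  have : B.compLeftContinuous ℝ unitInterval
      (ContinuousMap.primitive (B.compLeftContinuous ℝ unitInterval u)) = 0 := by
    ext t
    change B (ContinuousMap.primitive (B.compLeftContinuous ℝ unitInterval u) t) = 0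
    rw [ContinuousMap.primitive_apply, ← ContinuousLinearMap.intervalIntegral_comp_comm]
    · exact (intervalIntegral.integral_congr (g := fun _ => (0 : E)) fun s _ => hB _).trans
        intervalIntegral.integral_zero
    · exact ContinuousMap.intervalIntegrable_IccExtend _ _ _
  rw [this, map_zero]

/-- The derivative of `(z, u) ↦ (z, u - z - volterra u)` when the Volterra derivative `V` squares
to zero. -/
noncomputable def volterraEquiv (V : C(unitInterval, E) →L[ℝ] C(unitInterval, E))
    (hV : ∀ u, V (V u) = 0) :
    (E × C(unitInterval, E)) ≃L[ℝ] E × C(unitInterval, E) :=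
  ContinuousLinearEquiv.equivOfInverse
    ((ContinuousLinearMap.fst ℝ _ _).prod (ContinuousLinearMap.snd ℝ _ _ -
      ContinuousMap.constCLM ∘L ContinuousLinearMap.fst ℝ _ _ - V ∘L ContinuousLinearMap.snd ℝ _ _))
    ((ContinuousLinearMap.fst ℝ _ _).prod ((ContinuousLinearMap.id ℝ _ + V) ∘L
      (ContinuousLinearMap.snd ℝ _ _ + ContinuousMap.constCLM ∘L ContinuousLinearMap.fst ℝ _ _)))
    (fun p => Prod.ext rfl (by simp [hV]))
    (fun p => Prod.ext rfl (by simp [hV]; abel))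

/-- Smooth dependence on the initial value `z`, near a constant solution `z₀`, of the solution
`u z` of `u' = G(s, u)` on the unit interval, together with local uniqueness. -/
theorem exists_volterra_solution [CompleteSpace E] (hG : ContDiff ℝ ∞ G) {z₀ : E} {B : E →L[ℝ] E}
    (hB : ∀ s v, fderiv ℝ G (s, z₀) (0, v) = B v) (hB2 : ∀ v, B (B v) = 0)
    (hz₀ : ∀ s, G (s, z₀) = 0) :
    ∃ N : Set E, IsOpen N ∧ z₀ ∈ N ∧ ∃ S : E → C(unitInterval, E), ContDiffOn ℝ ∞ S N ∧
      S z₀ = ContinuousMap.constCLM z₀ ∧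
      HasFDerivAt (fun z => S z 1) (ContinuousLinearMap.id ℝ E + B) z₀ ∧
      (∀ z ∈ N, S z = ContinuousMap.constCLM z + volterra hG.continuous (S z)) ∧
      ∃ ε > 0, ∀ z u, dist z z₀ < ε → dist u (ContinuousMap.constCLM z₀) < ε →
        u = ContinuousMap.constCLM z + volterra hG.continuous u → u = S z := by
  set V : C(unitInterval, E) →L[ℝ] C(unitInterval, E) :=
    ContinuousMap.primitive ∘L B.compLeftContinuous ℝ unitInterval
  have hV : ∀ u, V (V u) = 0 := primitive_compLeftContinuous_sq hB2
  set c := ContinuousMap.constCLM (E := E)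
  -- `u` solves the integral equation with initial value `z` exactly when `ξ (z, u) = (z, 0)`; the
  -- solution map is thus read off from the local inverse of `ξ`.
  set ξ : E × C(unitInterval, E) → E × C(unitInterval, E) :=
    fun p => (p.1, p.2 - c p.1 - volterra hG.continuous p.2) with hξdef
  have hξ : ContDiff ℝ ∞ ξ :=
    contDiff_fst.prodMk ((contDiff_snd.sub (c.contDiff.comp contDiff_fst)).sub
      ((contDiff_volterra hG).comp contDiff_snd))
  have hξ' : HasFDerivAt ξ (volterraEquiv V hV : E × C(unitInterval, E) →L[ℝ] _) (z₀, c z₀) := by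
    refine HasFDerivAt.prodMk hasFDerivAt_fst ((hasFDerivAt_snd.sub
      (c.hasFDerivAt.comp _ hasFDerivAt_fst)).sub ?_)
    exact HasFDerivAt.comp (g := volterra hG.continuous) (f := Prod.snd) (z₀, c z₀)
      (hasFDerivAt_volterra hG hB) hasFDerivAt_snd
  obtain ⟨e, hsrc, -, he, -, hes⟩ := hξ.contDiffOn.exists_openPartialHomeomorph isOpen_univ
    (mem_univ _) hξ'
  have hfix : volterra hG.continuous (c z₀) = 0 := by
    ext t
    rw [volterra_apply]
    have : ∀ s : ℝ, G (s, IccExtend (zero_le_one (α := ℝ)) (c z₀) s) = 0 := fun s => hz₀ s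
    simp [this]
  have hbase : e (z₀, c z₀) = (z₀, 0) := by rw [he]; simp [hξdef, hfix]
  have hbase' : e.symm (z₀, 0) = (z₀, c z₀) := by rw [← hbase, e.left_inv hsrc]
  have hcont : Continuous fun z : E => (z, (0 : C(unitInterval, E))) := by fun_prop
  have htgt : (z₀, (0 : C(unitInterval, E))) ∈ e.target := hbase ▸ e.map_source hsrc
  refine ⟨(fun z : E => (z, (0 : C(unitInterval, E)))) ⁻¹' e.target,
    e.open_target.preimage hcont, htgt, fun z => (e.symm (z, 0)).2, ?_, ?_, ?_, ?_, ?_⟩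
  · exact (contDiff_snd.comp_contDiffOn hes).comp
      (contDiff_id.prodMk contDiff_const).contDiffOn fun z hz => hz
  · simp only [hbase']
  · have h1 : HasFDerivAt e (volterraEquiv V hV : E × C(unitInterval, E) →L[ℝ] _)
        (e.symm (z₀, 0)) := by
      rw [hbase']
      exact hξ'.congr_of_eventuallyEq (Eventually.of_forall he)
    have h2 := e.hasFDerivAt_symm htgt h1
    have h3 := HasFDerivAt.comp (g := e.symm) (f := fun z : E => (z, (0 : C(unitInterval, E)))) z₀
      h2 (HasFDerivAt.prodMk (hasFDerivAt_id z₀)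
      (hasFDerivAt_const (0 : C(unitInterval, E)) z₀))
    have h4 := ((ContinuousMap.evalCLM ℝ (1 : unitInterval)).hasFDerivAt.comp z₀
      ((ContinuousLinearMap.snd ℝ E C(unitInterval, E)).hasFDerivAt.comp z₀ h3))
    refine h4.congr_fderiv (ContinuousLinearMap.ext fun v => ?_)
    change ((ContinuousLinearMap.id ℝ C(unitInterval, E) + V) (0 + c v)) 1 = v + B v
    rw [zero_add]
    change v + ContinuousMap.primitive (B.compLeftContinuous ℝ unitInterval (c v)) 1 = v + B v
    rw [ContinuousMap.primitive_apply_of_eqOn (f := fun _ => B v) (fun s => rfl)]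
    simp
  · intro z hz
    have h1 : e (e.symm (z, 0)) = (z, 0) := e.right_inv hz
    rw [he] at h1
    have h2 : (e.symm (z, 0)).1 = z := congrArg Prod.fst h1
    have h3 := congrArg Prod.snd h1
    simp only [hξdef, h2] at h3
    rw [sub_sub, sub_eq_zero] at h3
    exact h3
  -- Local uniqueness is the injectivity of `e` on a ball inside its source.
  · obtain ⟨ε, hε, hball⟩ := Metric.isOpen_iff.1 e.open_source _ hsrc
    refine ⟨ε, hε, fun z u hz hu h => ?_⟩
    have h1 : (z, u) ∈ e.source := hball (by
      rw [Metric.mem_ball, Prod.dist_eq]; exact max_lt hz hu)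
    have h2 : e (z, u) = (z, 0) := by
      rw [he]
      refine Prod.ext rfl ?_
      simp only [hξdef]
      rw [sub_sub, sub_eq_zero]
      exact h
    simp only
    rw [← h2, e.left_inv h1]

end Volterra

/-! ### Linearization of a globally defined field P + R. -/

section Linearization

universe u

variable {E : Type u} [NormedAddCommGroup E] [NormedSpace ℝ E] {P : E →L[ℝ] E}

/-- The blown-up vector field has constant linear part at the points of the kernel of `P`. -/
lemma fderiv_dilation_blowup (hP : ∀ x, P (P x) = P x) {R : E → E} (hR : ContDiff ℝ ∞ R)
    {G : ℝ × E → E} (hG : ContDiff ℝ ∞ G)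
    (hRG : ∀ a w, R (dilation P a w) = a • dilation P a (G (a, w)))
    {z₀ : E} (hz₀ : P z₀ = 0) (hPB : ∀ v, P (fderiv ℝ R z₀ v) = 0)
    (hBP : ∀ v, fderiv ℝ R z₀ (P v) = fderiv ℝ R z₀ v) (s : ℝ) (v : E) :
    fderiv ℝ G (s, z₀) (0, v) = fderiv ℝ R z₀ v := by
  set B := fderiv ℝ R z₀
  have hcont : Continuous fun s : ℝ => fderiv ℝ G (s, z₀) (0, v) :=
    ((hG.continuous_fderiv (by simp)).comp (by fun_prop)).clm_apply continuous_const
  refine hcont.eq_of_forall_ne_zero continuous_const (fun s hs => ?_) s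
  have hd1 : HasFDerivAt (fun w => R (dilation P s w)) (B ∘L dilation P s) z₀ := by
    have h1 : HasFDerivAt R B (dilation P s z₀) := by
      rw [dilation_of_apply_eq_zero s hz₀]
      exact (hR.differentiable (by simp) z₀).hasFDerivAt
    exact h1.comp z₀ (dilation P s).hasFDerivAt
  have hd2 : HasFDerivAt (fun w => s • dilation P s (G (s, w)))
      (s • (dilation P s ∘L (fderiv ℝ G (s, z₀) ∘L ContinuousLinearMap.inr ℝ ℝ E))) z₀ := by
    have h1 : HasFDerivAt (fun w => G (s, w))
        (fderiv ℝ G (s, z₀) ∘L ContinuousLinearMap.inr ℝ ℝ E) z₀ :=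
      HasFDerivAt.comp (g := G) (f := fun w => (s, w)) z₀
        (hG.differentiable (by simp) (s, z₀)).hasFDerivAt (hasFDerivAt_prodMk_right s z₀)
    exact ((dilation P s).hasFDerivAt.comp z₀ h1).const_smul s
  rw [← funext fun w => hRG s w] at hd2
  have h3 := DFunLike.congr_fun (hd1.unique hd2) v
  simp only [ContinuousLinearMap.comp_apply, smul_apply,
    ContinuousLinearMap.inr_apply] at h3
  -- `B` sees only the normal part, so composing it with the dilation multiplies it by `s`. Its
  -- values are tangential, hence fixed by the dilation, so both the factor `s` and the dilation
  -- cancel.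
  rw [← hBP, apply_dilation hP, map_smul, hBP] at h3
  have h4 := smul_right_injective E hs h3
  rw [← dilation_of_apply_eq_zero s (hPB v)] at h4
  exact (dilation_injective hP hs h4).symm

/-- The blow-up is compatible with the dilations. -/
lemma smul_dilation_blowup (hP : ∀ x, P (P x) = P x) {R : E → E}
    {G : ℝ × E → E} (hG : ContDiff ℝ ∞ G)
    (hRG : ∀ a w, R (dilation P a w) = a • dilation P a (G (a, w)))
    (m s : ℝ) (w : E) :
    m • dilation P m (G (m * s, w)) = G (s, dilation P m w) := by
  have hGc := hG.continuous
  refine Continuous.eq_of_forall_ne_zero (f := fun s => m • dilation P m (G (m * s, w)))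
    (g := fun s => G (s, dilation P m w)) (by fun_prop) (by fun_prop) (fun s hs => ?_) s
  have h1 := hRG s (dilation P m w)
  rw [dilation_dilation hP, mul_comm, hRG, mul_comm m s, mul_smul] at h1
  have h2 := smul_right_injective E hs h1
  apply dilation_injective hP hs
  rw [map_smul, dilation_dilation hP, ← h2, mul_comm m s]

/-- The rescaled curve `s ↦ dilation m (u (m s))`. -/
noncomputable def rescaledCurve (P : E →L[ℝ] E) (m : unitInterval) (u : C(unitInterval, E)) :
    C(unitInterval, E) :=
  ⟨fun s => dilation P m (u (m * s)), by fun_prop⟩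

/-- Substitute s ↦ m s in the integral: by `smul_dilation_blowup` the resulting factor `m` and the
dilation turn `G (m * s, ·)` into `G (s, dilation P m ·)`. With uniqueness, this identifies the
rescaled curve as the solution starting at `dilation P m z`. -/
lemma rescaledCurve_eq [CompleteSpace E] (hP : ∀ x, P (P x) = P x) {R : E → E}
    {G : ℝ × E → E} (hG : ContDiff ℝ ∞ G)
    (hRG : ∀ a w, R (dilation P a w) = a • dilation P a (G (a, w)))
    {m : unitInterval} {u : C(unitInterval, E)} {z : E}
    (hu : u = ContinuousMap.constCLM z + volterra hG.continuous u) :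
    rescaledCurve P m u = ContinuousMap.constCLM (dilation P m z) +
      volterra hG.continuous (rescaledCurve P m u) := by
  ext t
  have h1 : u (m * t) = z + volterra hG.continuous u (m * t) := DFunLike.congr_fun hu (m * t)
  change dilation P m (u (m * t)) = dilation P m z + volterra hG.continuous (rescaledCurve P m u) t
  rw [h1, map_add, volterra_apply, volterra_apply]
  congr 1
  have hc : Continuous fun s : ℝ => G (s, IccExtend (zero_le_one (α := ℝ)) u s) :=
    hG.continuous.comp (continuous_id.prodMk u.continuous.Icc_extend')
  have h2 := intervalIntegral.smul_integral_comp_mul_left (a := 0) (b := (t : ℝ))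
    (fun s => G (s, IccExtend (zero_le_one (α := ℝ)) u s)) (m : ℝ)
  rw [mul_zero] at h2
  rw [show ((m * t : unitInterval) : ℝ) = (m : ℝ) * t from rfl, ← h2, map_smul,
    ← ContinuousLinearMap.intervalIntegral_comp_comm, ← intervalIntegral.integral_smul]
  · refine intervalIntegral.integral_congr fun s hs => ?_
    rw [uIcc_of_le t.2.1] at hs
    have hs' : s ∈ Icc (0 : ℝ) 1 := ⟨hs.1, hs.2.trans t.2.2⟩
    change (m : ℝ) • dilation P m (G (m * s, IccExtend (zero_le_one (α := ℝ)) u (m * s))) =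
      G (s, IccExtend (zero_le_one (α := ℝ)) (rescaledCurve P m u) s)
    have h3 : IccExtend (zero_le_one (α := ℝ)) u ((m : ℝ) * s) = u (m * ⟨s, hs'⟩) :=
      IccExtend_of_mem _ _ (m * ⟨s, hs'⟩ : unitInterval).2
    rw [smul_dilation_blowup hP hG hRG, IccExtend_of_mem _ _ hs', h3]
    rfl
  · exact (hc.comp (continuous_const.mul continuous_id)).intervalIntegrable _ _

/-- The vector field `P + R`, with `R` vanishing on the kernel of `P` and `P R` vanishing there to
second order, is the image of `P` under a smooth map with invertible derivative. -/
theorem exists_linearizing_map [CompleteSpace E] (hP : ∀ x, P (P x) = P x) {R : E → E}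
    (hR : ContDiff ℝ ∞ R) (h0 : ∀ z, P z = 0 → R z = 0)
    (h1 : ∀ z, P z = 0 → HasFDerivAt (fun y => P (R y)) (0 : E →L[ℝ] E) z)
    {z₀ : E} (hz₀ : P z₀ = 0) :
    ∃ (N : Set E) (Θ : E → E) (A : E ≃L[ℝ] E), IsOpen N ∧ z₀ ∈ N ∧ ContDiffOn ℝ ∞ Θ N ∧
      HasFDerivAt Θ (A : E →L[ℝ] E) z₀ ∧
      (∀ z ∈ N, P z = 0 → Θ z = z) ∧ ∀ z ∈ N, fderiv ℝ Θ z (P z) = P (Θ z) + R (Θ z) := by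
  obtain ⟨G, hG, hRG⟩ := hR.exists_dilation_blowup hP h0 h1
  set B := fderiv ℝ R z₀
  have hRB : HasFDerivAt R B z₀ := (hR.differentiable (by simp) z₀).hasFDerivAt
  have hPB : ∀ v, P (B v) = 0 := fun v => by
    have := (P.hasFDerivAt.comp z₀ hRB).unique (h1 z₀ hz₀)
    simpa using DFunLike.congr_fun this v
  -- `R` vanishes on the kernel of `P`, so its derivative kills the range of `id - P`.
  have hBP : ∀ v, B (P v) = B v := fun v => by
    have h2 : HasFDerivAt (fun y => R (y - P y)) (B ∘L (ContinuousLinearMap.id ℝ E - P)) z₀ := by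
      have h3 : HasFDerivAt R B (z₀ - P z₀) := by rwa [hz₀, sub_zero]
      exact HasFDerivAt.comp (g := R) (f := fun y => y - P y) z₀ h3
        ((hasFDerivAt_id z₀).sub P.hasFDerivAt)
    have h4 : (fun y => R (y - P y)) = fun _ => 0 := funext fun y => h0 _ (by simp [hP])
    rw [h4] at h2
    have h5 := DFunLike.congr_fun (h2.unique (hasFDerivAt_const 0 z₀)) v
    simp only [ContinuousLinearMap.comp_apply, sub_apply,
      ContinuousLinearMap.id_apply, map_sub, zero_apply] at h5
    exact (sub_eq_zero.1 h5).symm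
  have hB2 : ∀ v, B (B v) = 0 := fun v => by rw [← hBP, hPB, map_zero]
  have hGz : ∀ z, P z = 0 → ∀ s, G (s, z) = 0 := by
    intro z hz
    have hGc := hG.continuous
    refine Continuous.eq_of_forall_ne_zero (f := fun s => G (s, z)) (by fun_prop)
      continuous_const fun s hs => ?_
    have h2 := hRG s z
    rw [dilation_of_apply_eq_zero s hz, h0 z hz] at h2
    have h3 := (smul_eq_zero.1 h2.symm).resolve_left hs
    exact dilation_injective hP hs (by rw [h3, map_zero])
  obtain ⟨N₁, hN₁, hzN₁, S, hS, hSz₀, hS1, hSeq, ε, hε, huniq⟩ := exists_volterra_solution hG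
    (fderiv_dilation_blowup hP hR hG hRG hz₀ hPB hBP) hB2 (hGz z₀ hz₀)
  -- `c` bounds the norms of all dilations with parameter in [0,1]; closeness `ε / c` therefore
  -- keeps the rescaled curves within the uniqueness radius `ε`.
  set c := 1 + ‖P‖
  have hc : 0 < c := by positivity
  have hSc : ContinuousAt S z₀ := hS.continuousOn.continuousAt (hN₁.mem_nhds hzN₁)
  have hev : ∀ᶠ z in 𝓝 z₀, z ∈ N₁ ∧ dist z z₀ < ε / c ∧
      dist (S z) (ContinuousMap.constCLM z₀) < ε / c := by
    refine (show ∀ᶠ z in 𝓝 z₀, z ∈ N₁ from hN₁.mem_nhds hzN₁).and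
      (Eventually.and (Metric.ball_mem_nhds z₀ (by positivity)) ?_)
    rw [← hSz₀]
    exact hSc (Metric.ball_mem_nhds _ (by positivity))
  obtain ⟨N, hN, hNo, hzN⟩ := mem_nhds_iff.1 hev
  have hdil : ∀ m : unitInterval, ∀ x, ‖x - z₀‖ < ε / c → ‖dilation P m x - z₀‖ < ε := by
    intro m x hx
    have h2 : dilation P m x - z₀ = dilation P m (x - z₀) := by
      rw [map_sub, dilation_of_apply_eq_zero (m : ℝ) hz₀]
    rw [h2]
    calc _ ≤ c * ‖x - z₀‖ := norm_dilation_le m.2 _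
      _ < c * (ε / c) := by gcongr
      _ = ε := by field_simp
  have hscale : ∀ z ∈ N, ∀ m : unitInterval,
      S (dilation P m z) 1 = dilation P m (S z m) := by
    intro z hz m
    obtain ⟨hz1, hz2, hz3⟩ := hN hz
    have h2 := huniq (dilation P m z) (rescaledCurve P m (S z)) ?_ ?_
      (rescaledCurve_eq hP hG hRG (hSeq z hz1))
    · rw [← h2]
      change dilation P m (S z (m * 1)) = _
      rw [mul_one]
    · rw [dist_eq_norm]
      exact hdil m z (by rwa [← dist_eq_norm])
    · rw [dist_eq_norm, ContinuousMap.norm_lt_iff _ hε]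
      intro s
      refine hdil m (S z (m * s)) ?_
      rw [dist_eq_norm] at hz3
      exact ((S z - ContinuousMap.constCLM z₀).norm_coe_le_norm (m * s)).trans_lt hz3
  have hΘ : ContDiffOn ℝ ∞ (fun z => S z 1) N :=
    (ContinuousMap.evalCLM (M := E) ℝ (1 : unitInterval)).contDiff.comp_contDiffOn
      (hS.mono fun z hz => (hN hz).1)
  refine ⟨N, fun z => S z 1, ContinuousLinearEquiv.equivOfInverse
    (ContinuousLinearMap.id ℝ E + B) (ContinuousLinearMap.id ℝ E - B)
    (fun v => by simp [hB2]) (fun v => by simp [hB2]), hNo, hzN, hΘ, hS1, ?_, ?_⟩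
  · intro z hz hPz
    have hzε : dist z z₀ < ε := (hN hz).2.1.trans_le (div_le_self hε.le (by simp [c]))
    have h2 := huniq z (ContinuousMap.constCLM z) hzε ?_ ?_
    · exact (DFunLike.congr_fun h2 1).symm
    · rw [ContinuousMap.dist_lt_iff hε]
      exact fun _ => hzε
    · have h3 : volterra hG.continuous (ContinuousMap.constCLM z) = 0 := by
        ext t
        rw [volterra_apply]
        have h4 : ∀ s : ℝ, G (s, IccExtend (zero_le_one (α := ℝ))
          (ContinuousMap.constCLM z : C(unitInterval, E)) s) = 0 := fun s => hGz z hPz s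
        simp [h4]
      rw [h3, add_zero]
  intro z hz
  -- The integral continues `S z` past the unit interval, giving a two-sided derivative at `m = 1`.
  set w : ℝ → E := fun m => z + ∫ s in (0 : ℝ)..m, G (s, IccExtend (zero_le_one (α := ℝ)) (S z) s)
    with hwdef
  have hw : ∀ m : unitInterval, S z m = w m := fun m => by
    rw [hwdef]
    simp only
    rw [← volterra_apply hG.continuous]
    exact DFunLike.congr_fun (hSeq z (hN hz).1) m
  have hint : Continuous fun s : ℝ => G (s, IccExtend (zero_le_one (α := ℝ)) (S z) s) :=
    hG.continuous.comp (continuous_id.prodMk (S z).continuous.Icc_extend')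
  have hw1 : S z 1 = w 1 := hw 1
  have hw' : HasDerivAt w (R (S z 1)) 1 := by
    have h2 : HasDerivAt w (G (1, IccExtend (zero_le_one (α := ℝ)) (S z) 1)) 1 :=
      (intervalIntegral.integral_hasDerivAt_right (hint.intervalIntegrable _ _)
      (hint.stronglyMeasurableAtFilter _ _) hint.continuousAt).const_add z
    rw [IccExtend_right] at h2
    have h3 := hRG 1 (S z 1)
    rw [dilation_one, dilation_one, one_smul] at h3
    rw [h3]
    exact h2
  have hd1 : HasDerivAt (fun m : ℝ => S (dilation P m z) 1)
      (fderiv ℝ (fun z => S z 1) z (P z)) 1 := by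
    have h2 : HasFDerivAt (fun z => S z 1) (fderiv ℝ (fun z => S z 1) z) (dilation P 1 z) := by
      rw [dilation_one]
      exact ((hΘ.contDiffAt (hNo.mem_nhds hz)).differentiableAt (by simp)).hasFDerivAt
    exact h2.comp_hasDerivAt 1 (hasDerivAt_dilation 1 z)
  have hd2 : HasDerivAt (fun m : ℝ => dilation P m (w m)) (P (S z 1) + R (S z 1)) 1 := by
    simp only [dilation_apply]
    have h2 := (P.hasFDerivAt (x := w 1)).comp_hasDerivAt 1 hw'
    refine ((hw'.sub h2).add ((hasDerivAt_id (1 : ℝ)).smul h2)).congr_deriv ?_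
    simp only [id, one_smul, hw1, Function.comp_apply]
    abel
  -- The scaling identity is available only for `m ≤ 1`, so the two derivatives are compared from
  -- the left.
  have hud : UniqueDiffWithinAt ℝ (Iic (1 : ℝ)) 1 := uniqueDiffWithinAt_Iic 1
  refine hud.eq_deriv _ hd1.hasDerivWithinAt (hd2.hasDerivWithinAt.congr_of_eventuallyEq ?_ ?_)
  · filter_upwards [self_mem_nhdsWithin, mem_nhdsWithin_of_mem_nhds (Ioi_mem_nhds zero_lt_one)]
      with m hm1 hm0
    have hm : m ∈ Icc (0 : ℝ) 1 := ⟨le_of_lt hm0, hm1⟩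
    have h2 := hscale z hz ⟨m, hm⟩
    rw [hw ⟨m, hm⟩] at h2
    exact h2
  · simp [hw1]

end Linearization

/-! ### Localization of the normal form and of conjugation by dilations. -/

section LocalNormalForm

universe u

variable {E : Type u} [NormedAddCommGroup E] [NormedSpace ℝ E] [FiniteDimensional ℝ E]
  {F : Type*} [NormedAddCommGroup F] [NormedSpace ℝ F]

lemma exists_smooth_cutoff {Ω : Set E} (hΩ : IsOpen Ω) {z₀ : E} (hz₀ : z₀ ∈ Ω) :
    ∃ χ : E → ℝ, ContDiff ℝ ∞ χ ∧ tsupport χ ⊆ Ω ∧ ∀ᶠ z in 𝓝 z₀, χ z = 1 := by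
  obtain ⟨r, hr, hball⟩ := Metric.nhds_basis_closedBall.mem_iff.1 (hΩ.mem_nhds hz₀)
  let f : ContDiffBump z₀ := ⟨r / 2, r, by positivity, by linarith⟩
  exact ⟨f, f.contDiff, by rwa [f.tsupport_eq], f.eventuallyEq_one⟩

omit [FiniteDimensional ℝ E] in
lemma ContDiffOn.smul_of_tsupport_subset {Ω : Set E} (hΩ : IsOpen Ω) {χ : E → ℝ}
    (hχ : ContDiff ℝ ∞ χ) (hsupp : tsupport χ ⊆ Ω) {f : E → F} (hf : ContDiffOn ℝ ∞ f Ω) :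
    ContDiff ℝ ∞ (fun z => χ z • f z) := by
  rw [contDiff_iff_contDiffAt]
  intro z
  by_cases hz : z ∈ tsupport χ
  · exact hχ.contDiffAt.smul (hf.contDiffAt (hΩ.mem_nhds (hsupp hz)))
  · refine (contDiffAt_const (c := (0 : F))).congr_of_eventuallyEq ?_
    filter_upwards [notMem_tsupport_iff_eventuallyEq.1 hz] with y hy
    simp [hy]

variable {P : E →L[ℝ] E}

/-- **Normal form of Euler-like vector fields** in a vector space: near `z₀`, the vector field `X`
is the image of the linear vector field `P` under a diffeomorphism that fixes the kernel of `P`. -/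
theorem exists_linearizing_diffeo (hP : ∀ x, P (P x) = P x) {X : E → E} {Ω : Set E}
    (hΩ : IsOpen Ω) (hX : ContDiffOn ℝ ∞ X Ω) (h0 : ∀ z ∈ Ω, P z = 0 → X z = 0)
    (h1 : ∀ z ∈ Ω, P z = 0 → HasFDerivAt (fun y => P (X y) - P y) (0 : E →L[ℝ] E) z)
    {z₀ : E} (hz₀ : z₀ ∈ Ω) (hPz₀ : P z₀ = 0) :
    ∃ Θ : OpenPartialHomeomorph E E, z₀ ∈ Θ.source ∧ Θ.target ⊆ Ω ∧
      ContDiffOn ℝ ∞ Θ Θ.source ∧ ContDiffOn ℝ ∞ Θ.symm Θ.target ∧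
      (∀ z ∈ Θ.source, P z = 0 → Θ z = z) ∧
      ∀ z ∈ Θ.source, fderiv ℝ Θ z (P z) = X (Θ z) := by
  have : CompleteSpace E := FiniteDimensional.complete ℝ E
  obtain ⟨χ, hχ, hsupp, hone⟩ := exists_smooth_cutoff hΩ hz₀
  have hout : ∀ z, z ∉ Ω → ∀ᶠ y in 𝓝 z, χ y = 0 := fun z hz =>
    notMem_tsupport_iff_eventuallyEq.1 fun h => hz (hsupp h)
  -- Cutting off the remainder rather than `X` keeps the linear part `P` everywhere.
  have hR : ContDiff ℝ ∞ (fun z => χ z • (X z - P z)) :=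
    (hX.sub P.contDiff.contDiffOn).smul_of_tsupport_subset hΩ hχ hsupp
  have hR0 : ∀ z, P z = 0 → χ z • (X z - P z) = 0 := fun z hz => by
    by_cases hzΩ : z ∈ Ω
    · simp [h0 z hzΩ hz, hz]
    · simp [(hout z hzΩ).self_of_nhds]
  have hR1 : ∀ z, P z = 0 →
      HasFDerivAt (fun y => P (χ y • (X y - P y))) (0 : E →L[ℝ] E) z := fun z hz => by
    by_cases hzΩ : z ∈ Ω
    · have h2 := ((hχ.differentiable (by simp) z).hasFDerivAt).smul (h1 z hzΩ hz)
      have h3 : (fun y => P (χ y • (X y - P y))) = χ • fun y => P (X y) - P y := by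
        ext y; simp [hP]
      rw [h3]
      exact h2.congr_fderiv (by simp [h0 z hzΩ hz, hz])
    · refine (hasFDerivAt_const (0 : E) z).congr_of_eventuallyEq ?_
      filter_upwards [hout z hzΩ] with y hy
      simp [hy]
  obtain ⟨N, Θ₀, A, hN, hzN, hΘ₀, hA, hfix, hconj⟩ := exists_linearizing_map hP hR hR0 hR1 hPz₀
  -- On `W` the cutoff is 1, so the modified field is `X` there; the source of `Θ` is shrunk until
  -- its values lie in `W`.
  obtain ⟨W, hWsub, hW, hzW⟩ := mem_nhds_iff.1 (hone.and (hΩ.mem_nhds hz₀))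
  obtain ⟨Θ, hz₀s, hsub, hΘeq, hΘ, hΘs⟩ := (hΘ₀.mono inter_subset_left).exists_openPartialHomeomorph
    (hΘ₀.continuousOn.isOpen_inter_preimage hN hW)
    ⟨hzN, by rwa [mem_preimage, hfix z₀ hzN hPz₀]⟩ hA
  have hmem : ∀ z ∈ Θ.source, Θ z ∈ W := fun z hz => hΘeq z ▸ (hsub hz).2
  refine ⟨Θ, hz₀s, fun y hy => ?_, hΘ, hΘs, fun z hz hPz => ?_, fun z hz => ?_⟩
  · have := hmem _ (Θ.map_target hy)
    rw [Θ.right_inv hy] at this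
    exact (hWsub this).2
  · rw [hΘeq, hfix z (hsub hz).1 hPz]
  · have h2 := hconj z (hsub hz).1
    have h3 : χ (Θ z) = 1 := (hWsub (hmem z hz)).1
    rw [← hΘeq z, h3, one_smul, add_sub_cancel] at h2
    rw [← h2, show (Θ : E → E) = Θ₀ from funext hΘeq]

omit [NormedSpace ℝ E] [FiniteDimensional ℝ E] in
/-- A continuous family fixing `z₀` maps small neighbourhoods of `z₀` into small neighbourhoods,
uniformly for parameters in the unit interval. -/
lemma eventually_forall_Icc_of_fixed {f : ℝ × E → E} (hf : Continuous f) {z₀ : E}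
    (hfix : ∀ a, f (a, z₀) = z₀) {p : E → Prop} (hp : ∀ᶠ z in 𝓝 z₀, p z) :
    ∀ᶠ z in 𝓝 z₀, ∀ a ∈ Icc (0 : ℝ) 1, p (f (a, z)) := by
  refine isCompact_Icc.eventually_forall_of_forall_eventually fun a _ => ?_
  have h1 : Tendsto (fun q : E × ℝ => f (q.2, q.1)) (𝓝 (z₀, a)) (𝓝 z₀) := by
    have : Continuous fun q : E × ℝ => f (q.2, q.1) := by fun_prop
    simpa [hfix] using this.tendsto (z₀, a)
  exact h1.eventually hp

/-- The conjugates under the dilations of a local map that fixes the kernel of `P` extend smoothly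
to dilation parameter `0`. -/
theorem exists_local_dilation_conj (hP : ∀ x, P (P x) = P x) {T : E → E} {Ω : Set E}
    (hΩ : IsOpen Ω) (hT : ContDiffOn ℝ ∞ T Ω) (hfix : ∀ z ∈ Ω, P z = 0 → T z = z)
    {z₀ : E} (hz₀ : z₀ ∈ Ω) (hPz₀ : P z₀ = 0) :
    ∃ K : ℝ × E → E, ContDiff ℝ ∞ K ∧ (∀ a, K (a, z₀) = z₀) ∧
      ∀ᶠ z in 𝓝 z₀, ∀ a ∈ Icc (0 : ℝ) 1, dilation P a (K (a, z)) = T (dilation P a z) := by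
  obtain ⟨χ, hχ, hsupp, hone⟩ := exists_smooth_cutoff hΩ hz₀
  obtain ⟨K, hK, hKT⟩ := (hT.smul_of_tsupport_subset hΩ hχ hsupp).exists_dilation_conj hP
    (fun z hz => by
      by_cases hzΩ : z ∈ Ω
      · simp [hfix z hzΩ hz, hz]
      · simp [image_eq_zero_of_notMem_tsupport fun h => hzΩ (hsupp h)])
  refine ⟨K, hK, fun a => ?_, ?_⟩
  · refine Continuous.eq_of_forall_ne_zero (f := fun a => K (a, z₀))
      (hK.continuous.comp (by fun_prop)) continuous_const (fun a ha => ?_) a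
    apply dilation_injective hP ha
    rw [hKT, dilation_of_apply_eq_zero a hPz₀, hone.self_of_nhds, one_smul, hfix z₀ hz₀ hPz₀]
  · filter_upwards [eventually_forall_Icc_of_fixed (continuous_dilation (P := P))
      (fun a => dilation_of_apply_eq_zero a hPz₀) hone] with z hz a ha
    rw [hKT, hz a ha, one_smul]

/-- For a local diffeomorphism the conjugates under the dilations are local diffeomorphisms up to
dilation parameter `0`. -/
theorem exists_local_dilation_conj_equiv (hP : ∀ x, P (P x) = P x)
    (T : OpenPartialHomeomorph E E) (hT : ContDiffOn ℝ ∞ T T.source)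
    (hT' : ContDiffOn ℝ ∞ T.symm T.target) {z₀ : E} (hz₀ : z₀ ∈ T.source) (hPz₀ : P z₀ = 0)
    (hfix : ∀ᶠ z in 𝓝 z₀, P z = 0 → T z = z) :
    ∃ K : ℝ × E → E, ContDiff ℝ ∞ K ∧ (∀ a, K (a, z₀) = z₀) ∧
      ∀ᶠ z in 𝓝 z₀, ∀ a ∈ Icc (0 : ℝ) 1, dilation P a z ∈ T.source ∧
        dilation P a (K (a, z)) = T (dilation P a z) ∧
        ∃ A : E ≃L[ℝ] E, HasFDerivAt (fun z => K (a, z)) (A : E →L[ℝ] E) z := by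
  obtain ⟨Ω, hΩsub, hΩ, hzΩ⟩ := mem_nhds_iff.1 (hfix.and (T.open_source.mem_nhds hz₀))
  have hTz₀ : T z₀ = z₀ := (hΩsub hzΩ).1 hPz₀
  obtain ⟨K, hK, hKz₀, hKT⟩ := exists_local_dilation_conj hP hΩ
    (hT.mono fun z hz => (hΩsub hz).2) (fun z hz => (hΩsub hz).1) hzΩ hPz₀
  have htgt : z₀ ∈ T.target := hTz₀ ▸ T.map_source hz₀
  obtain ⟨K', hK', hKz₀', hKT'⟩ := exists_local_dilation_conj hP (hΩ.inter T.open_target)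
    (hT'.mono inter_subset_right) (fun z hz hPz => by
      rw [← congrArg T.symm ((hΩsub hz.1).1 hPz), T.left_inv (hΩsub hz.1).2]) ⟨hzΩ, htgt⟩ hPz₀
  have hsrc := eventually_forall_Icc_of_fixed (continuous_dilation (P := P))
    (fun a => dilation_of_apply_eq_zero a hPz₀) (T.open_source.mem_nhds hz₀)
  -- `K'` conjugates the inverse of `T`. For `a > 0` cancelling the dilation shows that it inverts
  -- `K` on the left, and this closed condition persists at `a = 0`. In finite dimension a left
  -- inverse of the derivative suffices.
  have hinv : ∀ᶠ z in 𝓝 z₀, ∀ a ∈ Icc (0 : ℝ) 1, K' (a, K (a, z)) = z := by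
    filter_upwards [hKT, hsrc, eventually_forall_Icc_of_fixed hK.continuous hKz₀ hKT']
      with z h1 h2 h3
    have hcl : IsClosed {a : ℝ | K' (a, K (a, z)) = z} := by
      have hKc := hK.continuous
      have hKc' := hK'.continuous
      exact isClosed_eq (by fun_prop) continuous_const
    have hsub : Ioc (0 : ℝ) 1 ⊆ {a : ℝ | K' (a, K (a, z)) = z} := fun a ha => by
      have ha' := Ioc_subset_Icc_self ha
      apply dilation_injective hP ha.1.ne'
      rw [h3 a ha' a ha', h1 a ha', T.left_inv (h2 a ha')]
    have := closure_minimal hsub hcl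
    rwa [closure_Ioc zero_ne_one] at this
  refine ⟨K, hK, hKz₀, ?_⟩
  filter_upwards [hKT, hsrc, hinv.eventually_nhds] with z h1 h2 h3 a ha
  refine ⟨h2 a ha, h1 a ha, ?_⟩
  have hd : ∀ {L : ℝ × E → E}, ContDiff ℝ ∞ L → ∀ y,
      HasFDerivAt (fun z => L (a, z)) (fderiv ℝ (fun z => L (a, z)) y) y := fun {L} hL y => by
    have : ContDiff ℝ ∞ fun z => L (a, z) := hL.comp (contDiff_const.prodMk contDiff_id)
    exact (this.differentiable (by simp) y).hasFDerivAt
  have hcomp := (hd hK' (K (a, z))).comp z (hd hK z)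
  have hid : ((fun z => K' (a, z)) ∘ fun z => K (a, z)) =ᶠ[𝓝 z] id :=
    h3.mono fun y hy => hy a ha
  have heq := (hcomp.congr_of_eventuallyEq hid.symm).unique (hasFDerivAt_id z)
  set B := fderiv ℝ (fun z => K (a, z)) z
  have hinj : Function.Injective (B : E →ₗ[ℝ] E) := fun v w hvw => by
    have hv := DFunLike.congr_fun heq v
    have hw := DFunLike.congr_fun heq w
    simp only [ContinuousLinearMap.comp_apply, ContinuousLinearMap.id_apply] at hv hw
    rw [← hv, ← hw]
    exact congrArg _ hvw
  exact ⟨(LinearEquiv.ofInjectiveEndo (B : E →ₗ[ℝ] E) hinj).toContinuousLinearEquiv, hd hK z⟩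

end LocalNormalForm

/-! ### Euler fields in slice charts. -/

namespace EulerField

/-- The projection of `ℝⁿ⁺ᵈ` onto the last `d` coordinates, as an endomorphism. -/
noncomputable def normalProj (n d : ℕ) :
    EuclideanSpace ℝ (Fin (n + d)) →L[ℝ] EuclideanSpace ℝ (Fin (n + d)) :=
  LinearMap.toContinuousLinearMap
    { toFun := fun x => WithLp.toLp 2 fun i => if n ≤ (i : ℕ) then x i else 0
      map_add' := fun x y => by
        ext i
        by_cases h : n ≤ (i : ℕ) <;> simp [h]
      map_smul' := fun c x => by
        ext i
        by_cases h : n ≤ (i : ℕ) <;> simp [h] }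

section NormalProj

variable {n d : ℕ}

lemma normalProj_apply (x : EuclideanSpace ℝ (Fin (n + d))) (i : Fin (n + d)) :
    normalProj n d x i = if n ≤ (i : ℕ) then x i else 0 := rfl

lemma normalProj_normalProj (x : EuclideanSpace ℝ (Fin (n + d))) :
    normalProj n d (normalProj n d x) = normalProj n d x := by
  ext i
  by_cases h : n ≤ (i : ℕ) <;> simp [normalProj_apply, h]

lemma normalProj_eq_zero_iff {x : EuclideanSpace ℝ (Fin (n + d))} :
    normalProj n d x = 0 ↔ ∀ j : Fin d, x (Fin.natAdd n j) = 0 := by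
  refine ⟨fun h j => ?_, fun h => ?_⟩
  · have := congrArg (fun y : EuclideanSpace ℝ (Fin (n + d)) => y (Fin.natAdd n j)) h
    simpa [normalProj_apply] using this
  · ext i
    rw [normalProj_apply]
    split_ifs with hi
    · have := h ⟨i - n, by omega⟩
      rwa [show Fin.natAdd n ⟨(i : ℕ) - n, by omega⟩ = i from Fin.ext (by simp; omega)] at this
    · rfl

end NormalProj

variable {n d : ℕ} {M : Type*} [TopologicalSpace M]
  [ChartedSpace (EuclideanSpace ℝ (Fin (n + d))) M]

/-- The representation of the vector field `X` in the chart `φ`. -/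
noncomputable def chartField (φ : OpenPartialHomeomorph M (EuclideanSpace ℝ (Fin (n + d))))
    (X : (x : M) → TangentSpace (𝓡 (n + d)) x) (z : EuclideanSpace ℝ (Fin (n + d))) :
    EuclideanSpace ℝ (Fin (n + d)) :=
  mfderiv (𝓡 (n + d)) 𝓘(ℝ, EuclideanSpace ℝ (Fin (n + d))) φ (φ.symm z) (X (φ.symm z))

lemma contDiffOn_chartField [IsManifold (𝓡 (n + d)) ∞ M]
    {φ : OpenPartialHomeomorph M (EuclideanSpace ℝ (Fin (n + d)))}
    (hφ : φ ∈ IsManifold.maximalAtlas (𝓡 (n + d)) ∞ M) {U : Opens M}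
    {X : (x : M) → TangentSpace (𝓡 (n + d)) x} (hX : IsSmoothFieldOn U X) :
    ContDiffOn ℝ ∞ (chartField φ X) (φ.target ∩ φ.symm ⁻¹' U) := by
  have h1 := (contMDiffOn_of_mem_maximalAtlas hφ).contMDiffOn_tangentMapWithin (m := ∞)
    (by simp) φ.open_source.uniqueMDiffOn
  have h2 : ContMDiffOn 𝓘(ℝ, EuclideanSpace ℝ (Fin (n + d))) (𝓡 (n + d)).tangent ∞
      (fun z => (⟨φ.symm z, X (φ.symm z)⟩ : TangentBundle (𝓡 (n + d)) M))
      (φ.target ∩ φ.symm ⁻¹' U) :=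
    ContMDiffOn.comp (g := fun x => (⟨x, X x⟩ : TangentBundle (𝓡 (n + d)) M)) hX
      ((contMDiffOn_symm_of_mem_maximalAtlas hφ).mono inter_subset_left) fun z hz => hz.2
  have h3 := (contMDiff_snd_tangentBundle_modelSpace (EuclideanSpace ℝ (Fin (n + d)))
    (𝓡 (n + d)) (n := ∞)).comp_contMDiffOn (h1.comp h2 fun z hz => φ.map_target hz.1)
  rw [← contMDiffOn_iff_contDiffOn]
  refine h3.congr fun z hz => ?_
  exact (DFunLike.congr_fun (mfderivWithin_of_isOpen φ.open_source (φ.map_target hz.1))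
    (X (φ.symm z))).symm

lemma contDiffAt_extend_comp_symm [IsManifold (𝓡 (n + d)) ∞ M]
    {φ : OpenPartialHomeomorph M (EuclideanSpace ℝ (Fin (n + d)))}
    (hφ : φ ∈ IsManifold.maximalAtlas (𝓡 (n + d)) ∞ M) {U : Opens M}
    (f : C^∞⟮𝓡 (n + d), U; 𝓘(ℝ, ℝ), ℝ⟯) {z : EuclideanSpace ℝ (Fin (n + d))}
    (hz : z ∈ φ.target) (hzU : φ.symm z ∈ U) :
    ContDiffAt ℝ ∞ (fun y => Function.extend ((↑) : U → M) f 0 (φ.symm y)) z := by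
  have h1 : ContMDiffAt (𝓡 (n + d)) 𝓘(ℝ, ℝ) ∞ (Function.extend ((↑) : U → M) f 0) (φ.symm z) := by
    rw [← contMDiffAt_subtype_iff (x := ⟨φ.symm z, hzU⟩)]
    refine (f.contMDiff ⟨φ.symm z, hzU⟩).congr_of_eventuallyEq (Eventually.of_forall fun x => ?_)
    exact Subtype.val_injective.extend_apply _ _ _
  rw [← contMDiffAt_iff_contDiffAt]
  exact h1.comp z ((contMDiffOn_symm_of_mem_maximalAtlas hφ).contMDiffAt
    (φ.open_target.mem_nhds hz))

/-- Functions in the square of the vanishing ideal vanish to second order on `I`. -/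
lemma hasFDerivAt_of_mem_vanishingIdeal_sq [IsManifold (𝓡 (n + d)) ∞ M] {I : Set M}
    {φ : OpenPartialHomeomorph M (EuclideanSpace ℝ (Fin (n + d)))}
    (hφ : φ ∈ IsManifold.maximalAtlas (𝓡 (n + d)) ∞ M) {U : Opens M}
    {g : C^∞⟮𝓡 (n + d), U; 𝓘(ℝ, ℝ), ℝ⟯} (hg : g ∈ vanishingIdeal (n := n) (d := d) I U ^ 2)
    {z : EuclideanSpace ℝ (Fin (n + d))}
    (hz : z ∈ φ.target) (hzU : φ.symm z ∈ U) (hzI : φ.symm z ∈ I) :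
    g ⟨φ.symm z, hzU⟩ = 0 ∧ HasFDerivAt (fun y => Function.extend ((↑) : U → M) g 0 (φ.symm y))
      (0 : EuclideanSpace ℝ (Fin (n + d)) →L[ℝ] ℝ) z := by
  have hU : ∀ᶠ y in 𝓝 z, φ.symm y ∈ U :=
    (φ.symm.continuousAt hz).eventually (U.isOpen.mem_nhds hzU)
  have hext : ∀ (f : C^∞⟮𝓡 (n + d), U; 𝓘(ℝ, ℝ), ℝ⟯) (y) (hy : φ.symm y ∈ U),
      Function.extend ((↑) : U → M) f 0 (φ.symm y) = f ⟨φ.symm y, hy⟩ := fun f y hy =>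
    Subtype.val_injective.extend_apply f 0 (⟨φ.symm y, hy⟩ : U)
  rw [pow_two] at hg
  refine Submodule.mul_induction_on hg (fun a ha b hb => ?_) (fun a b ha hb => ?_)
  · have ha0 : a ⟨φ.symm z, hzU⟩ = 0 := ha _ hzI
    have hb0 : b ⟨φ.symm z, hzU⟩ = 0 := hb _ hzI
    refine ⟨by simp [ha0], ?_⟩
    have h1 := ((contDiffAt_extend_comp_symm hφ a hz hzU).differentiableAt (by simp)).hasFDerivAt
    have h2 := ((contDiffAt_extend_comp_symm hφ b hz hzU).differentiableAt (by simp)).hasFDerivAt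
    have h3 := h1.mul h2
    rw [hext a z hzU, hext b z hzU, ha0, hb0, zero_smul, zero_smul, add_zero] at h3
    refine h3.congr_of_eventuallyEq ?_
    filter_upwards [hU] with y hy
    simp only [Pi.mul_apply]
    rw [hext _ y hy, hext _ y hy, hext _ y hy]
    simp
  · refine ⟨by simp [ha.1, hb.1], ?_⟩
    have h3 := ha.2.add hb.2
    rw [add_zero] at h3
    refine h3.congr_of_eventuallyEq ?_
    filter_upwards [hU] with y hy
    simp only [Pi.add_apply]
    rw [hext _ y hy, hext _ y hy, hext _ y hy]
    simp

/-- The Euler condition read in a slice chart, for functions of the coordinates that vanish on the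
slice. -/
theorem IsEulerOn.exists_test [T2Space M] [IsManifold (𝓡 (n + d)) ∞ M] {I : Set M} {U : Opens M}
    {ρ : (x : M) → TangentSpace (𝓡 (n + d)) x} (hρ : IsEulerOn I U ρ)
    {φ : OpenPartialHomeomorph M (EuclideanSpace ℝ (Fin (n + d)))}
    (hφ : φ ∈ IsManifold.maximalAtlas (𝓡 (n + d)) ∞ M)
    (hI : ∀ q ∈ φ.source, q ∈ I ↔ normalProj n d (φ q) = 0)
    {p : M} (hpφ : p ∈ φ.source) (hpU : p ∈ U) :
    ∃ Ω : Set (EuclideanSpace ℝ (Fin (n + d))), IsOpen Ω ∧ φ p ∈ Ω ∧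
      Ω ⊆ φ.target ∩ φ.symm ⁻¹' U ∧
      ∀ F : EuclideanSpace ℝ (Fin (n + d)) → ℝ, ContDiff ℝ ∞ F →
        (∀ z, normalProj n d z = 0 → F z = 0) → ∀ z ∈ Ω, normalProj n d z = 0 →
          fderiv ℝ F z (chartField φ ρ z) = 0 ∧
          HasFDerivAt (fun y => fderiv ℝ F y (chartField φ ρ y) - F y)
            (0 : EuclideanSpace ℝ (Fin (n + d)) →L[ℝ] ℝ) z := by
  obtain ⟨b, -, hb⟩ := (SmoothBumpFunction.nhds_basis_tsupport (I := 𝓡 (n + d)) p).mem_iff.1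
    (φ.open_source.mem_nhds hpφ)
  have hev : ∀ᶠ z in 𝓝 (φ p), (∀ᶠ x in 𝓝 (φ.symm z), b x = 1) ∧ z ∈ φ.target ∧ φ.symm z ∈ U := by
    have ht := φ.symm.continuousAt (φ.map_source hpφ)
    rw [ContinuousAt, φ.left_inv hpφ] at ht
    exact (ht.eventually b.eventuallyEq_one.eventually_nhds).and
      (Eventually.and (φ.open_target.mem_nhds (φ.map_source hpφ)) (ht.eventually (U.isOpen.mem_nhds hpU)))
  obtain ⟨Ω, hΩsub, hΩ, hpΩ⟩ := mem_nhds_iff.1 hev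
  refine ⟨Ω, hΩ, hpΩ, fun z hz => (hΩsub hz).2, fun F hF hF0 z hz hPz => ?_⟩
  -- The Euler condition concerns functions on all of `U`; the bump function makes `F ∘ φ` one of
  -- them without changing it near the points of `Ω`.
  have hFφ : ContMDiff (𝓡 (n + d)) 𝓘(ℝ, ℝ) ∞ (fun x => b x • F (φ x)) := by
    refine contMDiff_of_tsupport fun x hx => ?_
    have hx' : x ∈ φ.source := hb (tsupport_smul_subset_left _ _ hx)
    exact b.contMDiffAt.smul (hF.contMDiff.contMDiffAt.comp x
      (contMDiffAt_of_mem_maximalAtlas hφ hx'))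
  set f : C^∞⟮𝓡 (n + d), U; 𝓘(ℝ, ℝ), ℝ⟯ :=
    ⟨fun x => b x • F (φ x), hFφ.comp contMDiff_subtype_val⟩ with hfdef
  have hf : f ∈ vanishingIdeal (n := n) (d := d) I U := by
    intro x hx
    change b x • F (φ x) = 0
    by_cases hxφ : (x : M) ∈ φ.source
    · rw [hF0 _ ((hI x hxφ).1 hx), smul_zero]
    · rw [image_eq_zero_of_notMem_tsupport fun h => hxφ (hb h), zero_smul]
  obtain ⟨g, hg, hfg⟩ := hρ.2 f hf
  have hlie : ∀ y ∈ Ω, ∀ hyU : φ.symm y ∈ U,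
      fderiv ℝ F y (chartField φ ρ y) - F y = g ⟨φ.symm y, hyU⟩ := by
    intro y hy hyU
    obtain ⟨hy1, hy2, -⟩ := hΩsub hy
    rw [← hfg ⟨φ.symm y, hyU⟩]
    congr 1
    · unfold lieDeriv
      have h1 : Function.extend ((↑) : U → M) f 0 =ᶠ[𝓝 (φ.symm y)] F ∘ φ := by
        filter_upwards [hy1, U.isOpen.mem_nhds hyU] with x hx hxU
        rw [Subtype.val_injective.extend_apply f 0 (⟨x, hxU⟩ : U)]
        change b x • F (φ x) = F (φ x)
        rw [hx, one_smul]
      simp only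
      rw [h1.mfderiv_eq]
      have h2 : MDifferentiableAt 𝓘(ℝ, EuclideanSpace ℝ (Fin (n + d))) 𝓘(ℝ, ℝ) F
          (φ (φ.symm y)) := (hF.differentiable (by simp)).mdifferentiable _
      have h3 : MDifferentiableAt (𝓡 (n + d)) 𝓘(ℝ, EuclideanSpace ℝ (Fin (n + d))) φ
          (φ.symm y) := (contMDiffAt_of_mem_maximalAtlas hφ
            (φ.map_target hy2)).mdifferentiableAt (by simp)
      rw [mfderiv_comp _ h2 h3, mfderiv_eq_fderiv, φ.right_inv hy2]
      rfl
    · change F y = b (φ.symm y) • F (φ (φ.symm y))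
      rw [hy1.self_of_nhds, one_smul, φ.right_inv hy2]
  obtain ⟨-, hz2, hz3⟩ := hΩsub hz
  have hzI : φ.symm z ∈ I := (hI _ (φ.map_target hz2)).2 (by rwa [φ.right_inv hz2])
  obtain ⟨h0, h1⟩ := hasFDerivAt_of_mem_vanishingIdeal_sq hφ hg hz2 hz3 hzI
  refine ⟨?_, h1.congr_of_eventuallyEq ?_⟩
  · have := hlie z hz hz3
    rwa [h0, hF0 z hPz, sub_zero] at this
  · filter_upwards [hΩ.mem_nhds hz] with y hy
    rw [hlie y hy (hΩsub hy).2.2]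
    exact (Subtype.val_injective.extend_apply g 0 (⟨φ.symm y, (hΩsub hy).2.2⟩ : U)).symm

/-- In a slice chart, an Euler vector field vanishes on the slice, and its normal part agrees with
the linear Euler field to second order. -/
theorem IsEulerOn.exists_chartField [T2Space M] [IsManifold (𝓡 (n + d)) ∞ M] (hd : 0 < d)
    {I : Set M} {U : Opens M}
    {ρ : (x : M) → TangentSpace (𝓡 (n + d)) x} (hρ : IsEulerOn I U ρ)
    {φ : OpenPartialHomeomorph M (EuclideanSpace ℝ (Fin (n + d)))}
    (hφ : φ ∈ IsManifold.maximalAtlas (𝓡 (n + d)) ∞ M)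
    (hI : ∀ q ∈ φ.source, q ∈ I ↔ normalProj n d (φ q) = 0)
    {p : M} (hpφ : p ∈ φ.source) (hpU : p ∈ U) :
    ∃ Ω : Set (EuclideanSpace ℝ (Fin (n + d))), IsOpen Ω ∧ φ p ∈ Ω ∧
      Ω ⊆ φ.target ∩ φ.symm ⁻¹' U ∧ ContDiffOn ℝ ∞ (chartField φ ρ) Ω ∧
      (∀ z ∈ Ω, normalProj n d z = 0 → chartField φ ρ z = 0) ∧
      ∀ z ∈ Ω, normalProj n d z = 0 → HasFDerivAt
        (fun y => normalProj n d (chartField φ ρ y) - normalProj n d y)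
        (0 : EuclideanSpace ℝ (Fin (n + d)) →L[ℝ] EuclideanSpace ℝ (Fin (n + d))) z := by
  obtain ⟨Ω, hΩ, hpΩ, hΩsub, htest⟩ := hρ.exists_test hφ hI hpφ hpU
  have hX : ContDiffOn ℝ ∞ (chartField φ ρ) Ω := (contDiffOn_chartField hφ hρ.1).mono hΩsub
  set X := chartField φ ρ
  refine ⟨Ω, hΩ, hpΩ, hΩsub, hX, fun z hz hPz => ?_, fun z hz hPz => ?_⟩
  · set j₀ : Fin (n + d) := Fin.natAdd n ⟨0, hd⟩
    set h : EuclideanSpace ℝ (Fin (n + d)) →L[ℝ] ℝ := EuclideanSpace.proj j₀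
    have hh0 : ∀ y, normalProj n d y = 0 → h y = 0 := fun y hy => normalProj_eq_zero_iff.1 hy _
    ext i
    set g : EuclideanSpace ℝ (Fin (n + d)) →L[ℝ] ℝ := EuclideanSpace.proj i
    obtain ⟨hv1, hd1⟩ := htest h h.contDiff hh0 z hz hPz
    -- X(g h) - g h = g (X h - h) + h X(g), and the terms other than h X(g) are of second order at
    -- `z`. The derivative of h X(g) at `z` in the direction `j₀` is the `i`-th component of `X z`,
    -- which is therefore zero.
    obtain ⟨-, hd2⟩ := htest (fun y => g y * h y) (g.contDiff.mul h.contDiff)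
      (fun y hy => by rw [hh0 y hy, mul_zero]) z hz hPz
    have hfd : ∀ y v, fderiv ℝ (fun y => g y * h y) y v = g y * h v + h y * g v := fun y v => by
      have := (g.hasFDerivAt (x := y)).mul (h.hasFDerivAt (x := y))
      rw [show (fun y => g y * h y) = ⇑g * ⇑h from rfl, this.fderiv]
      simp
    simp only [ContinuousLinearMap.fderiv] at hv1 hd1
    have hd3 : HasFDerivAt (fun y => h y * g (X y)) (0 : _ →L[ℝ] ℝ) z := by
      have h1 := hd2.sub ((g.hasFDerivAt (x := z)).mul hd1)
      rw [hv1, hh0 z hPz, sub_zero, zero_smul, smul_zero, add_zero, sub_zero] at h1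
      refine h1.congr_of_eventuallyEq (Eventually.of_forall fun y => ?_)
      simp only [Pi.sub_apply, Pi.mul_apply, hfd]
      ring
    have hXz : HasFDerivAt X (fderiv ℝ X z) z :=
      ((hX.contDiffAt (hΩ.mem_nhds hz)).differentiableAt (by simp)).hasFDerivAt
    have hd4 := (h.hasFDerivAt (x := z)).mul ((g.hasFDerivAt (x := X z)).comp z hXz)
    have heq := DFunLike.congr_fun (hd4.unique hd3) (EuclideanSpace.single j₀ (1 : ℝ))
    simpa [hh0 z hPz, h, g] using heq
  · rw [← hasFDerivWithinAt_univ, hasFDerivWithinAt_euclidean]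
    intro i
    have h1 := (htest (fun y => normalProj n d y i)
      ((EuclideanSpace.proj i ∘L normalProj n d).contDiff (n := ∞))
      (fun y hy => by rw [hy]; rfl) z hz hPz).2
    have hfd : ∀ y v, fderiv ℝ (fun y => normalProj n d y i) y v = normalProj n d v i :=
      fun y v => DFunLike.congr_fun (EuclideanSpace.proj i ∘L normalProj n d).fderiv v
    simp only [hfd] at h1
    rw [hasFDerivWithinAt_univ]
    exact h1.congr_fderiv (by simp)

end EulerField

/-! ### Transport of maps, fields and flows between the chart and the manifold. -/

lemma OpenPartialHomeomorph.contDiffOn_trans {E F G : Type*} [NormedAddCommGroup E]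
    [NormedSpace ℝ E] [NormedAddCommGroup F] [NormedSpace ℝ F] [NormedAddCommGroup G]
    [NormedSpace ℝ G] {e : OpenPartialHomeomorph E F} {e' : OpenPartialHomeomorph F G}
    (he : ContDiffOn ℝ ∞ e e.source) (he' : ContDiffOn ℝ ∞ e' e'.source) :
    ContDiffOn ℝ ∞ (e.trans e') (e.trans e').source :=
  he'.comp (he.mono fun _ hx => hx.1) fun _ hx => hx.2

lemma OpenPartialHomeomorph.contDiffOn_trans_symm {E F G : Type*} [NormedAddCommGroup E]
    [NormedSpace ℝ E] [NormedAddCommGroup F] [NormedSpace ℝ F] [NormedAddCommGroup G]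
    [NormedSpace ℝ G] {e : OpenPartialHomeomorph E F} {e' : OpenPartialHomeomorph F G}
    (he : ContDiffOn ℝ ∞ e.symm e.target) (he' : ContDiffOn ℝ ∞ e'.symm e'.target) :
    ContDiffOn ℝ ∞ (e.trans e').symm (e.trans e').target :=
  he.comp (he'.mono fun _ hx => hx.1) fun _ hx => hx.2

namespace EulerField

variable {n d : ℕ} {M : Type*} [TopologicalSpace M]

/-- A local homeomorphism of the model space, read on the manifold through the chart `φ`. -/
noncomputable def chartConj (φ : OpenPartialHomeomorph M (EuclideanSpace ℝ (Fin (n + d))))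
    (e : OpenPartialHomeomorph (EuclideanSpace ℝ (Fin (n + d)))
      (EuclideanSpace ℝ (Fin (n + d)))) : OpenPartialHomeomorph M M :=
  (φ.trans e).trans φ.symm

section ChartConj

variable {φ : OpenPartialHomeomorph M (EuclideanSpace ℝ (Fin (n + d)))}
  {e : OpenPartialHomeomorph (EuclideanSpace ℝ (Fin (n + d))) (EuclideanSpace ℝ (Fin (n + d)))}

lemma chartConj_symm : (chartConj φ e).symm = chartConj φ e.symm := by
  simp only [chartConj, OpenPartialHomeomorph.trans_symm_eq_symm_trans_symm,
    OpenPartialHomeomorph.symm_symm, OpenPartialHomeomorph.trans_assoc]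

lemma mem_chartConj_source {x : M} :
    x ∈ (chartConj φ e).source ↔ x ∈ φ.source ∧ φ x ∈ e.source ∧ e (φ x) ∈ φ.target := by
  simp [chartConj, and_assoc]

lemma mem_chartConj_target {x : M} :
    x ∈ (chartConj φ e).target ↔ x ∈ φ.source ∧ φ x ∈ e.target ∧ e.symm (φ x) ∈ φ.target := by
  rw [← OpenPartialHomeomorph.symm_source, chartConj_symm, mem_chartConj_source]
  rfl

variable [ChartedSpace (EuclideanSpace ℝ (Fin (n + d))) M]

lemma contMDiffOn_chartConj [IsManifold (𝓡 (n + d)) ∞ M]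
    (hφ : φ ∈ IsManifold.maximalAtlas (𝓡 (n + d)) ∞ M) (he : ContDiffOn ℝ ∞ e e.source) :
    ContMDiffOn (𝓡 (n + d)) (𝓡 (n + d)) ∞ (chartConj φ e) (chartConj φ e).source :=
  (contMDiffOn_symm_of_mem_maximalAtlas hφ).comp
    (he.contMDiffOn.comp ((contMDiffOn_of_mem_maximalAtlas hφ).mono
      fun _ hx => (mem_chartConj_source.1 hx).1) fun _ hx => (mem_chartConj_source.1 hx).2.1)
    fun _ hx => (mem_chartConj_source.1 hx).2.2

/-- A smooth local homeomorphism read through a chart is a partial diffeomorphism. -/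
noncomputable def chartConjDiffeo [IsManifold (𝓡 (n + d)) ∞ M]
    (hφ : φ ∈ IsManifold.maximalAtlas (𝓡 (n + d)) ∞ M) (he : ContDiffOn ℝ ∞ e e.source)
    (he' : ContDiffOn ℝ ∞ e.symm e.target) :
    PartialDiffeomorph (𝓡 (n + d)) (𝓡 (n + d)) M M ∞ where
  toPartialEquiv := (chartConj φ e).toPartialEquiv
  open_source := (chartConj φ e).open_source
  open_target := (chartConj φ e).open_target
  contMDiffOn_toFun := contMDiffOn_chartConj hφ he
  contMDiffOn_invFun := by
    have := contMDiffOn_chartConj (e := e.symm) hφ he'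
    rw [← chartConj_symm] at this
    exact this

end ChartConj

variable [ChartedSpace (EuclideanSpace ℝ (Fin (n + d))) M]

section ChartField

variable {φ : OpenPartialHomeomorph M (EuclideanSpace ℝ (Fin (n + d)))}

lemma chartField_apply {ρ : (x : M) → TangentSpace (𝓡 (n + d)) x} {x : M} (hx : x ∈ φ.source) :
    chartField φ ρ (φ x) =
      mfderiv (𝓡 (n + d)) 𝓘(ℝ, EuclideanSpace ℝ (Fin (n + d))) φ x (ρ x) :=
  congrArg (fun y => (mfderiv (𝓡 (n + d)) 𝓘(ℝ, EuclideanSpace ℝ (Fin (n + d))) φ y (ρ y) :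
    EuclideanSpace ℝ (Fin (n + d)))) (φ.left_inv hx)

lemma mfderiv_symm_chartField [IsManifold (𝓡 (n + d)) ∞ M]
    (hφ : φ ∈ IsManifold.maximalAtlas (𝓡 (n + d)) ∞ M)
    {ρ : (x : M) → TangentSpace (𝓡 (n + d)) x} {z : EuclideanSpace ℝ (Fin (n + d))}
    (hz : z ∈ φ.target) :
    mfderiv 𝓘(ℝ, EuclideanSpace ℝ (Fin (n + d))) (𝓡 (n + d)) φ.symm z (chartField φ ρ z) =
      ρ (φ.symm z) := by
  have h : φ.MDifferentiable (𝓡 (n + d)) 𝓘(ℝ, EuclideanSpace ℝ (Fin (n + d))) :=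
    ⟨(contMDiffOn_of_mem_maximalAtlas hφ).mdifferentiableOn (by simp),
      (contMDiffOn_symm_of_mem_maximalAtlas hφ).mdifferentiableOn (by simp)⟩
  have h1 := h.symm_comp_deriv (φ.map_target hz)
  rw [φ.right_inv hz] at h1
  exact DFunLike.congr_fun h1 (ρ (φ.symm z))

/-- If `e` relates the chart representations of two vector fields, then the conjugate of `e` pushes
one vector field forward to the other. -/
lemma pushforward_chartConj [IsManifold (𝓡 (n + d)) ∞ M]
    (hφ : φ ∈ IsManifold.maximalAtlas (𝓡 (n + d)) ∞ M)
    {ρ₁ ρ₂ : (x : M) → TangentSpace (𝓡 (n + d)) x}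
    {e : OpenPartialHomeomorph (EuclideanSpace ℝ (Fin (n + d))) (EuclideanSpace ℝ (Fin (n + d)))}
    (he : ContDiffOn ℝ ∞ e e.source)
    (hrel : ∀ z ∈ e.source, fderiv ℝ e z (chartField φ ρ₂ z) = chartField φ ρ₁ (e z))
    {y : M} (hy : y ∈ (chartConj φ e).target) :
    ρ₁ y = pushforward (chartConj φ e) ρ₂ y := by
  obtain ⟨x, hx, rfl⟩ : ∃ x ∈ (chartConj φ e).source, chartConj φ e x = y :=
    ⟨_, (chartConj φ e).map_target hy, (chartConj φ e).right_inv hy⟩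
  have hsymm : (chartConj φ e).symm (chartConj φ e x) = x := (chartConj φ e).left_inv hx
  unfold pushforward
  rw [hsymm]
  obtain ⟨hx1, hx2, hx3⟩ := mem_chartConj_source.1 hx
  have hd1 : MDifferentiableAt (𝓡 (n + d)) 𝓘(ℝ, EuclideanSpace ℝ (Fin (n + d))) φ x :=
    (contMDiffAt_of_mem_maximalAtlas hφ hx1).mdifferentiableAt (by simp)
  have hd2 : MDifferentiableAt 𝓘(ℝ, EuclideanSpace ℝ (Fin (n + d)))
      𝓘(ℝ, EuclideanSpace ℝ (Fin (n + d))) e (φ x) :=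
    ((he.contDiffAt (e.open_source.mem_nhds hx2)).differentiableAt (by simp)).mdifferentiableAt
  have hd3 : MDifferentiableAt 𝓘(ℝ, EuclideanSpace ℝ (Fin (n + d))) (𝓡 (n + d)) φ.symm (e (φ x)) :=
    ((contMDiffOn_symm_of_mem_maximalAtlas hφ).contMDiffAt
      (φ.open_target.mem_nhds hx3)).mdifferentiableAt (by simp)
  have h1 : mfderiv (𝓡 (n + d)) (𝓡 (n + d)) (φ.symm ∘ (e ∘ φ)) x (ρ₂ x) =
      mfderiv 𝓘(ℝ, EuclideanSpace ℝ (Fin (n + d))) (𝓡 (n + d)) φ.symm (e (φ x))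
        (chartField φ ρ₁ (e (φ x))) := by
    rw [← hrel _ hx2, chartField_apply hx1, mfderiv_comp x hd3 (hd2.comp x hd1),
      mfderiv_comp x hd2 hd1, mfderiv_eq_fderiv]
    rfl
  rw [mfderiv_symm_chartField hφ hx3] at h1
  exact h1.symm

/-- The image under a linearization `Θ` of the curves of the linear Euler field are integral
curves. -/
lemma isMIntegralCurveOn_of_linearization [IsManifold (𝓡 (n + d)) ∞ M]
    (hφ : φ ∈ IsManifold.maximalAtlas (𝓡 (n + d)) ∞ M)
    {ρ : (x : M) → TangentSpace (𝓡 (n + d)) x}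
    {Θ : OpenPartialHomeomorph (EuclideanSpace ℝ (Fin (n + d))) (EuclideanSpace ℝ (Fin (n + d)))}
    (hΘ : ContDiffOn ℝ ∞ Θ Θ.source) (htgt : Θ.target ⊆ φ.target)
    (hrel : ∀ z ∈ Θ.source, fderiv ℝ Θ z (normalProj n d z) = chartField φ ρ (Θ z))
    {z : EuclideanSpace ℝ (Fin (n + d))} {s : Set ℝ}
    (hs : ∀ t ∈ s, dilation (normalProj n d) (Real.exp t) z ∈ Θ.source) :
    IsMIntegralCurveOn (I := 𝓡 (n + d))
      (fun t => φ.symm (Θ (dilation (normalProj n d) (Real.exp t) z))) ρ s := by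
  intro t ht
  apply HasMFDerivAt.hasMFDerivWithinAt
  have hw := hs t ht
  set w := dilation (normalProj n d) (Real.exp t) z with hwdef
  have h1 : HasDerivAt (fun t => Θ (dilation (normalProj n d) (Real.exp t) z))
      (chartField φ ρ (Θ w)) t := by
    have h2 := ((hΘ.contDiffAt (Θ.open_source.mem_nhds hw)).differentiableAt
      (by simp)).hasFDerivAt
    have h3 : HasDerivAt (fun t => dilation (normalProj n d) (Real.exp t) z)
        (normalProj n d w) t := by
      rw [hwdef, apply_dilation normalProj_normalProj]
      exact (hasDerivAt_dilation (P := normalProj n d) (Real.exp t) z).scomp t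
        (Real.hasDerivAt_exp t)
    rw [← hrel w hw]
    exact h2.comp_hasDerivAt t h3
  have hwt : Θ w ∈ φ.target := htgt (Θ.map_source hw)
  have h4 : HasMFDerivAt 𝓘(ℝ, EuclideanSpace ℝ (Fin (n + d))) (𝓡 (n + d)) φ.symm (Θ w)
      (mfderiv 𝓘(ℝ, EuclideanSpace ℝ (Fin (n + d))) (𝓡 (n + d)) φ.symm (Θ w)) :=
    (((contMDiffOn_symm_of_mem_maximalAtlas hφ).contMDiffAt
      (φ.open_target.mem_nhds hwt)).mdifferentiableAt (by simp)).hasMFDerivAt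
  have h5 := HasMFDerivAt.comp t h4 h1.hasFDerivAt.hasMFDerivAt
  refine h5.congr_mfderiv (ContinuousLinearMap.ext fun (r : ℝ) => ?_)
  change mfderiv 𝓘(ℝ, EuclideanSpace ℝ (Fin (n + d))) (𝓡 (n + d)) φ.symm (Θ w)
    (r • chartField φ ρ (Θ w)) = r • ρ (φ.symm (Θ w))
  have h6 := mfderiv_symm_chartField hφ (ρ := ρ) hwt
  exact (ContinuousLinearMap.map_smul _ r _).trans (congrArg (fun v => r • v) h6)

/-- Times between log λ and 0 correspond to dilation parameters in [λ, 1], so `hz` keeps the whole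
trajectory inside the linearized region. -/
lemma scalesTo_of_linearization [IsManifold (𝓡 (n + d)) ∞ M]
    (hφ : φ ∈ IsManifold.maximalAtlas (𝓡 (n + d)) ∞ M)
    {ρ : (x : M) → TangentSpace (𝓡 (n + d)) x} {U : Opens M}
    {Θ : OpenPartialHomeomorph (EuclideanSpace ℝ (Fin (n + d))) (EuclideanSpace ℝ (Fin (n + d)))}
    (hΘ : ContDiffOn ℝ ∞ Θ Θ.source) (htgt : Θ.target ⊆ φ.target ∩ φ.symm ⁻¹' U)
    (hrel : ∀ z ∈ Θ.source, fderiv ℝ Θ z (normalProj n d z) = chartField φ ρ (Θ z))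
    {z : EuclideanSpace ℝ (Fin (n + d))}
    (hz : ∀ a ∈ Icc (0 : ℝ) 1, dilation (normalProj n d) a z ∈ Θ.source)
    {lam : ℝ} (hlam : lam ∈ Ioc (0 : ℝ) 1) :
    ScalesTo ρ U lam (φ.symm (Θ z)) (φ.symm (Θ (dilation (normalProj n d) lam z))) := by
  have hexp : ∀ t ∈ uIcc 0 (Real.log lam),
      dilation (normalProj n d) (Real.exp t) z ∈ Θ.source := by
    intro t ht
    rw [uIcc_of_ge (Real.log_nonpos hlam.1.le hlam.2)] at ht
    exact hz _ ⟨(Real.exp_pos t).le, Real.exp_le_one_iff.2 ht.2⟩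
  refine ⟨_, isMIntegralCurveOn_of_linearization hφ hΘ (htgt.trans inter_subset_left) hrel hexp,
    fun t ht => (htgt (Θ.map_source (hexp t ht))).2, ?_, ?_⟩
  · simp
  · simp only [Real.exp_log hlam.1]

end ChartField

/-- A linearization of an Euler vector field in a slice chart. -/
theorem IsEulerOn.exists_linearization [T2Space M] [IsManifold (𝓡 (n + d)) ∞ M] (hd : 0 < d)
    {I : Set M} {U : Opens M}
    {ρ : (x : M) → TangentSpace (𝓡 (n + d)) x} (hρ : IsEulerOn I U ρ)
    {φ : OpenPartialHomeomorph M (EuclideanSpace ℝ (Fin (n + d)))}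
    (hφ : φ ∈ IsManifold.maximalAtlas (𝓡 (n + d)) ∞ M)
    (hI : ∀ q ∈ φ.source, q ∈ I ↔ normalProj n d (φ q) = 0)
    {p : M} (hpφ : p ∈ φ.source) (hpU : p ∈ U) (hpI : p ∈ I) :
    ∃ Θ : OpenPartialHomeomorph (EuclideanSpace ℝ (Fin (n + d))) (EuclideanSpace ℝ (Fin (n + d))),
      φ p ∈ Θ.source ∧ Θ.target ⊆ φ.target ∩ φ.symm ⁻¹' U ∧
      ContDiffOn ℝ ∞ Θ Θ.source ∧ ContDiffOn ℝ ∞ Θ.symm Θ.target ∧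
      (∀ z ∈ Θ.source, normalProj n d z = 0 → Θ z = z) ∧
      ∀ z ∈ Θ.source, fderiv ℝ Θ z (normalProj n d z) = chartField φ ρ (Θ z) := by
  obtain ⟨Ω, hΩ, hpΩ, hΩsub, hX, h0, h1⟩ := hρ.exists_chartField hd hφ hI hpφ hpU
  obtain ⟨Θ, hp, htgt, hrest⟩ := exists_linearizing_diffeo normalProj_normalProj hΩ hX h0 h1 hpΩ
    ((hI p hpφ).1 hpI)
  exact ⟨Θ, hp, htgt.trans hΩsub, hrest⟩

end EulerField

/-! ### Conjugation of the two fields and comparison of their scaling flows. -/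

open EulerField in
theorem mainTheorem8 {n d : ℕ} (hd : 0 < d)
    {M : Type*} [TopologicalSpace M] [T2Space M]
    [ChartedSpace (EuclideanSpace ℝ (Fin (n + d))) M] [IsManifold (𝓡 (n + d)) ∞ M]
    (I : Set M) (hI : EulerField.IsEmbeddedSubmanifold n d I)
    (p : M) (hp : p ∈ I)
    (U₁ U₂ : TopologicalSpace.Opens M) (hp₁ : p ∈ U₁) (hp₂ : p ∈ U₂)
    (ρ₁ ρ₂ : (x : M) → TangentSpace (𝓡 (n + d)) x)
    (hρ₁ : EulerField.IsEulerOn I U₁ ρ₁) (hρ₂ : EulerField.IsEulerOn I U₂ ρ₂) :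
    (∃ Ψ : OpenPartialHomeomorph M M,
      p ∈ Ψ.source ∧ Ψ p = p ∧ Ψ.source ⊆ U₂ ∧ Ψ.target ⊆ U₁ ∧
      ContMDiffOn (𝓡 (n + d)) (𝓡 (n + d)) ∞ Ψ Ψ.source ∧
      ContMDiffOn (𝓡 (n + d)) (𝓡 (n + d)) ∞ Ψ.symm Ψ.target ∧
      ∀ y ∈ Ψ.target, ρ₁ y = EulerField.pushforward Ψ ρ₂ y) ∧
    (∃ (V : TopologicalSpace.Opens M) (Φ : ℝ → M → M),
      EulerField.IsSmoothFamilyOfDiffeoGerms n d p V Φ ∧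
      ∀ lam ∈ Set.Ioc (0 : ℝ) 1, ∀ x ∈ V, ∃ y : M,
        EulerField.ScalesTo ρ₂ U₂ lam x y ∧
        EulerField.ScalesTo ρ₁ U₁ lam (Φ lam x) y) := by
  obtain ⟨φ, hφ, hpφ, hφI⟩ := hI p hp
  have hφI' : ∀ q ∈ φ.source, q ∈ I ↔ normalProj n d (φ q) = 0 := fun q hq => by
    rw [hφI q hq, normalProj_eq_zero_iff]
  obtain ⟨Θ₁, hz₁, htgt₁, hΘ₁, hΘs₁, hfix₁, hrel₁⟩ :=
    hρ₁.exists_linearization hd hφ hφI' hpφ hp₁ hp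
  obtain ⟨Θ₂, hz₂, htgt₂, hΘ₂, hΘs₂, hfix₂, hrel₂⟩ :=
    hρ₂.exists_linearization hd hφ hφI' hpφ hp₂ hp
  have hPz := (hφI' p hpφ).1 hp
  have hΘp₁ : Θ₁ (φ p) = φ p := hfix₁ _ hz₁ hPz
  have hΘp₂ : Θ₂ (φ p) = φ p := hfix₂ _ hz₂ hPz
  have hzt₁ : φ p ∈ Θ₁.target := hΘp₁ ▸ Θ₁.map_source hz₁
  have hzt₂ : φ p ∈ Θ₂.target := hΘp₂ ▸ Θ₂.map_source hz₂
  have hΘsp₂ : Θ₂.symm (φ p) = φ p := by rw [← congrArg Θ₂.symm hΘp₂, Θ₂.left_inv hz₂]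
  constructor
  -- Both chart fields are images of the same linear field, so going back along `Θ₂` and forward
  -- along `Θ₁` relates them.
  · set e := Θ₂.symm.trans Θ₁
    have he : ContDiffOn ℝ ∞ e e.source := OpenPartialHomeomorph.contDiffOn_trans hΘs₂ hΘ₁
    have hes : ContDiffOn ℝ ∞ e.symm e.target :=
      OpenPartialHomeomorph.contDiffOn_trans_symm (e := Θ₂.symm) hΘ₂ hΘs₁
    have hrel : ∀ z ∈ e.source, fderiv ℝ e z (chartField φ ρ₂ z) = chartField φ ρ₁ (e z) := by
      intro z hz
      have hz' : z ∈ Θ₂.target := hz.1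
      have hw := Θ₂.map_target hz'
      have hw1 : Θ₂.symm z ∈ Θ₁.source := hz.2
      have h1 : HasFDerivAt Θ₂ (fderiv ℝ Θ₂ (Θ₂.symm z)) (Θ₂.symm z) :=
        ((hΘ₂.contDiffAt (Θ₂.open_source.mem_nhds hw)).differentiableAt (by simp)).hasFDerivAt
      have h2 : HasFDerivAt e (fderiv ℝ e z) (Θ₂ (Θ₂.symm z)) := by
        rw [Θ₂.right_inv hz']
        exact ((he.contDiffAt (e.open_source.mem_nhds hz)).differentiableAt (by simp)).hasFDerivAt
      have h3 : Θ₁ =ᶠ[𝓝 (Θ₂.symm z)] e ∘ Θ₂ := by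
        filter_upwards [Θ₂.open_source.mem_nhds hw] with w hw
        change Θ₁ w = Θ₁ (Θ₂.symm (Θ₂ w))
        rw [Θ₂.left_inv hw]
      have h4 := ((h2.comp _ h1).congr_of_eventuallyEq h3).fderiv
      have h5 := hrel₁ _ hw1
      rw [h4, ContinuousLinearMap.comp_apply, hrel₂ _ hw, Θ₂.right_inv hz'] at h5
      exact h5
    have hmem : p ∈ (chartConj φ e).source := by
      refine mem_chartConj_source.2 ⟨hpφ, ⟨hzt₂, ?_⟩, ?_⟩
      · change Θ₂.symm (φ p) ∈ Θ₁.source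
        rwa [hΘsp₂]
      · change Θ₁ (Θ₂.symm (φ p)) ∈ φ.target
        rw [hΘsp₂, hΘp₁]
        exact φ.map_source hpφ
    refine ⟨chartConj φ e, hmem, ?_, fun x hx => ?_, fun y hy => ?_, contMDiffOn_chartConj hφ he,
      ?_, fun y hy => pushforward_chartConj hφ he hrel hy⟩
    · change φ.symm (Θ₁ (Θ₂.symm (φ p))) = p
      rw [hΘsp₂, hΘp₁, φ.left_inv hpφ]
    · obtain ⟨hx1, hx2, -⟩ := mem_chartConj_source.1 hx
      have := (htgt₂ hx2.1).2
      rwa [mem_preimage, φ.left_inv hx1] at this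
    · obtain ⟨hy1, hy2, -⟩ := mem_chartConj_target.1 hy
      have := (htgt₁ hy2.1).2
      rwa [mem_preimage, φ.left_inv hy1] at this
    · have := contMDiffOn_chartConj (e := e.symm) hφ hes
      rwa [← chartConj_symm] at this
  · set T := Θ₂.trans Θ₁.symm
    have hT : ContDiffOn ℝ ∞ T T.source := OpenPartialHomeomorph.contDiffOn_trans hΘ₂ hΘs₁
    have hTs : ContDiffOn ℝ ∞ T.symm T.target :=
      OpenPartialHomeomorph.contDiffOn_trans_symm (e' := Θ₁.symm) hΘs₂ hΘ₁
    have hTz : φ p ∈ T.source := by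
      refine ⟨hz₂, ?_⟩
      change Θ₂ (φ p) ∈ Θ₁.target
      rwa [hΘp₂]
    have hTfix : ∀ᶠ z in 𝓝 (φ p), normalProj n d z = 0 → T z = z := by
      filter_upwards [Θ₁.open_source.mem_nhds hz₁, Θ₂.open_source.mem_nhds hz₂] with z h1 h2 hz
      change Θ₁.symm (Θ₂ z) = z
      rw [hfix₂ z h2 hz, ← congrArg Θ₁.symm (hfix₁ z h1 hz), Θ₁.left_inv h1]
    obtain ⟨K, hK, hKz, hKT⟩ := exists_local_dilation_conj_equiv normalProj_normalProj T hT hTs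
      hTz hPz hTfix
    have hdil : ∀ {S : Set (EuclideanSpace ℝ (Fin (n + d)))}, S ∈ 𝓝 (φ p) → ∀ᶠ z in 𝓝 (φ p),
        ∀ a ∈ Icc (0 : ℝ) 1, dilation (normalProj n d) a z ∈ S := fun hS =>
      eventually_forall_Icc_of_fixed continuous_dilation
        (fun a => dilation_of_apply_eq_zero a hPz) hS
    -- For `z ∈ N` the dilates of `z` stay in `Θ₂.source` and all dilates of every `K (a, z)` in
    -- `Θ₁.source`, so both scaling trajectories exist.
    obtain ⟨N, hNsub, hN, hzN⟩ := mem_nhds_iff.1 (hKT.and ((hdil (Θ₂.open_source.mem_nhds hz₂)).and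
      (eventually_forall_Icc_of_fixed hK.continuous hKz (hdil (Θ₁.open_source.mem_nhds hz₁)))))
    have hK₁ : ∀ z ∈ N, ∀ a ∈ Icc (0 : ℝ) 1, K (a, z) ∈ Θ₁.source := fun z hz a ha => by
      simpa using (hNsub hz).2.2 a ha 1 (right_mem_Icc.2 zero_le_one)
    refine ⟨⟨φ.source ∩ φ ⁻¹' (Θ₂.target ∩ Θ₂.symm ⁻¹' N),
      φ.isOpen_inter_preimage (Θ₂.symm.isOpen_inter_preimage hN)⟩,
      fun a x => φ.symm (Θ₁ (K (a, Θ₂.symm (φ x)))), ⟨?_, ?_, fun a ha => ⟨?_, ?_⟩⟩, ?_⟩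
    · exact ⟨hpφ, hzt₂, by rwa [mem_preimage, hΘsp₂]⟩
    · have h1 : ContMDiffOn (𝓘(ℝ, ℝ).prod (𝓡 (n + d)))
          𝓘(ℝ, EuclideanSpace ℝ (Fin (n + d))) ∞ (fun q : ℝ × M => Θ₂.symm (φ q.2))
          (Icc (0 : ℝ) 1 ×ˢ (φ.source ∩ φ ⁻¹' (Θ₂.target ∩ Θ₂.symm ⁻¹' N))) :=
        hΘs₂.contMDiffOn.comp ((contMDiffOn_of_mem_maximalAtlas hφ).comp contMDiffOn_snd
          fun q hq => hq.2.1) fun q hq => hq.2.2.1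
      have h2 := hK.contMDiff.comp_contMDiffOn (contMDiffOn_fst.prodMk_space h1)
      exact (contMDiffOn_symm_of_mem_maximalAtlas hφ).comp (hΘ₁.contMDiffOn.comp h2
        fun q hq => hK₁ _ hq.2.2.2 _ hq.1)
        fun q hq => (htgt₁ (Θ₁.map_source (hK₁ _ hq.2.2.2 _ hq.1))).1
    · change φ.symm (Θ₁ (K (a, Θ₂.symm (φ p)))) = p
      rw [hΘsp₂, hKz, hΘp₁, φ.left_inv hpφ]
    · rintro ⟨x, hx1, hx2, hx3⟩
      obtain ⟨-, -, A, hA⟩ := (hNsub hx3).1 a ha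
      -- With `a` fixed, possibly 0, the inverse function theorem at this point makes `K (a, ·)` a
      -- local diffeomorphism.
      obtain ⟨k, hk1, -, hkeq, hk, hks⟩ := (hK.comp (contDiff_const.prodMk
        contDiff_id)).contDiffOn.exists_openPartialHomeomorph isOpen_univ (mem_univ _) hA
      set e := Θ₂.symm.trans (k.trans Θ₁)
      have he : ContDiffOn ℝ ∞ e e.source := OpenPartialHomeomorph.contDiffOn_trans hΘs₂
        (OpenPartialHomeomorph.contDiffOn_trans hk hΘ₁)
      have hes : ContDiffOn ℝ ∞ e.symm e.target :=
        OpenPartialHomeomorph.contDiffOn_trans_symm (e := Θ₂.symm) hΘ₂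
          (OpenPartialHomeomorph.contDiffOn_trans_symm hks hΘs₁)
      have hke : ∀ y, e (φ y) = Θ₁ (K (a, Θ₂.symm (φ y))) := fun y =>
        congrArg Θ₁ (hkeq (Θ₂.symm (φ y)))
      have hK₁' := hK₁ _ hx3 a ha
      refine ⟨chartConjDiffeo hφ he hes, mem_chartConj_source.2 ⟨hx1, ⟨hx2, hk1, ?_⟩, ?_⟩,
        fun y _ => congrArg φ.symm (hke y).symm⟩
      · change k (Θ₂.symm (φ x)) ∈ Θ₁.source
        rw [hkeq]
        exact hK₁'
      · rw [hke]
        exact (htgt₁ (Θ₁.map_source hK₁')).1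
    · rintro lam hlam x ⟨hx1, hx2, hx3⟩
      have hlam' := Ioc_subset_Icc_self hlam
      obtain ⟨h1, h2, h3⟩ := hNsub hx3
      obtain ⟨h4, h5, -⟩ := h1 lam hlam'
      refine ⟨φ.symm (Θ₂ (dilation (normalProj n d) lam (Θ₂.symm (φ x)))), ?_, ?_⟩
      · have := scalesTo_of_linearization hφ hΘ₂ htgt₂ hrel₂ h2 hlam
        rwa [Θ₂.right_inv hx2, φ.left_inv hx1] at this
      · have := scalesTo_of_linearization hφ hΘ₁ htgt₁ hrel₁ (h3 lam hlam') hlam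
        rw [h5] at this
        have h6 : Θ₁ (T (dilation (normalProj n d) lam (Θ₂.symm (φ x)))) = Θ₂ (dilation (normalProj n d) lam (Θ₂.symm (φ x))) :=
          Θ₁.right_inv h4.2
        rwa [h6] at this
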